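/- **Theorem 3.1 (Compactness of $\mathbb{G}^\Omega$).** Let $s,\gamma\in(0,1]$, let $N>2s$, let $\Omega\subset\mathbb{R}^N$ be a bounded $C^2$ domain, let $\delta(x)=\operatorname{dist}(x,\mathbb{R}^N\setminus\Omega)$, and let $D_\Omega=\{(x,x):x\in\Omega\}$. Let $\mathbb{L}$ be a linear operator in $L^2(\Omega)$ with domain $\operatorname{dom}(\mathbb L)\subset L^2(\Omega)$, and assume: * (G1) there is an operator $\mathbb{G}^\Omega$ such that for every $f\in C_c^\infty(\Omega)$ one has $\mathbb{G}^\Omega[f]\in\operatorname{dom}(\mathbb L)$ and $\mathbb{L}[\mathbb{G}^\Omega[f]]=f$ in $L^2(\Omega)$; * (G2) $\mathbb{G}^\Omega[f](x)=\int_\Omega G^\Omega(x,y)f(y)\,dy$ for $f\in C_c^\infty(\Omega)$ and $x\in\Omega$, where $G^\Omega:(\Omega\times\Omega)\setminus D_\Omega\to(0,\infty)$ is Borel measurable and symmetric and there are constants $c,C>0$ with $c\,\Phi(x,y)\le G^\Omega(x,y)\le C\,\Phi(x,y)$ for all $x\ne y$ in $\Omega$, where $$\Phi(x,y)=\frac{1}{|x-y|^{N-2s}}\left(\frac{\delta(x)}{|x-y|}\wedge1\right)^{\gamma}\left(\frac{\delta(y)}{|x-y|}\wedge1\right)^{\gamma};$$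 * (G3*) $G^\Omega$ is jointly continuous on $(\Omega\times\Omega)\setminus D_\Omega$. For $\beta\ge0$ let $\mathcal{M}(\Omega,\delta^{\beta})$ be the space of signed Radon measures $\mu$ on $\Omega$ with $\|\mu\|_{\mathcal{M}(\Omega,\delta^\beta)}:=\int_\Omega\delta^{\beta}\,d|\mu|<\infty$; for $\alpha\in\mathbb R$ and $1\le q<\infty$ let $L^q(\Omega,\delta^\alpha)$ be the $L^q$ space of the measure $\delta^\alpha dx$ on $\Omega$; and set $\mathbb{G}^\Omega[\mu](x)=\int_\Omega G^\Omega(x,y)\,d\mu(y)$. (i) Let $\gamma'\in[0,\gamma)$ and let $\alpha$ satisfy $$(-\gamma'-1)\vee(\gamma'-2s)\vee\left(-\frac{\gamma'N}{N-2s+\gamma'}\right)<\alpha<\frac{\gamma'N}{N-2s}.$$ Then for every $q$ with $1\le q<p^*_{\gamma',\alpha}:=\frac{N+\alpha}{N+\gamma'-2s}$, the map $\mathbb{G}^\Omega:\mathcal{M}(\Omega,\delta^{\gamma'})\to L^q(\Omega,\delta^\alpha)$ is well defined (for each $\mu$ the integral converges absolutely for a.e. $x\in\Omega$, and $\mathbb{G}^\Omega[\mu]\in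 L^q(\Omega,\delta^\alpha)$) and compact, that is, the image of every bounded sequence has a subsequence converging in $L^q(\Omega,\delta^\alpha)$. (ii) Assume in addition that (G4) holds: for every $x_0\in\Omega$ and $z_0\in\partial\Omega$ the limit $$M^\Omega(x_0,z_0)=\lim_{\Omega\times\Omega\ni(x,y)\to(x_0,z_0)}\frac{G^\Omega(x,y)}{\delta(y)^\gamma}$$ exists, and $M^\Omega:\Omega\times\partial\Omega\to[0,\infty)$ is continuous. Then (i) also holds with $\gamma'=\gamma$. -/

import Mathlib

open MeasureTheory Set Filter Topology
open scoped ENNReal ContDiff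

namespace GreenCompactness

/-- Euclidean space `ℝ^N`. -/
abbrev Eu (N : ℕ) : Type := EuclideanSpace ℝ (Fin N)

/-- A bounded domain of class `C²`: a nonempty connected bounded open set which near each of its
boundary points is the strict sublevel set `{φ < 0}` of a `C²` function whose differential does not
vanish at that point. -/
structure IsC2BoundedDomain {N : ℕ} (Ω : Set (Eu N)) : Prop where
  isOpen : IsOpen Ω
  isConnected : IsConnected Ω
  isBounded : Bornology.IsBounded Ω
  boundary : ∀ z ∈ frontier Ω, ∃ r : ℝ, 0 < r ∧ ∃ φ : Eu N → ℝ,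
    ContDiff ℝ 2 φ ∧ fderiv ℝ φ z ≠ 0 ∧ ∀ x ∈ Metric.ball z r, x ∈ Ω ↔ φ x < 0

/-- `δ(x)`, the distance from `x` to `ℝ^N ∖ Ω`. -/
noncomputable def bdist {N : ℕ} (Ω : Set (Eu N)) (x : Eu N) : ℝ := Metric.infDist x Ωᶜ

/-- `(Ω × Ω) ∖ D_Ω`, the product with the diagonal removed. -/
def offDiagonal {N : ℕ} (Ω : Set (Eu N)) : Set (Eu N × Eu N) :=
  {p | p.1 ∈ Ω ∧ p.2 ∈ Ω ∧ p.1 ≠ p.2}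

/-- `C_c^∞(Ω)`. -/
structure IsTestFunction {N : ℕ} (Ω : Set (Eu N)) (f : Eu N → ℝ) : Prop where
  contDiff : ContDiff ℝ ∞ f
  hasCompactSupport : HasCompactSupport f
  tsupport_subset : tsupport f ⊆ Ω

/-- `L²(Ω)`. -/
abbrev L2 {N : ℕ} (Ω : Set (Eu N)) : Type :=
  Lp ℝ 2 ((volume : Measure (Eu N)).restrict Ω)

/-- The operator `𝔾`, on test functions, is a right inverse of the (possibly unbounded) linear
operator `L` of `L²(Ω)`: for every `f ∈ C_c^∞(Ω)`, `𝔾[f]` belongs to the domain of `L` and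
`L[𝔾[f]] = f` in `L²(Ω)`. -/
def IsGreenOperator {N : ℕ} (Ω : Set (Eu N)) (L : L2 Ω →ₗ.[ℝ] L2 Ω)
    (GG : (Eu N → ℝ) → Eu N → ℝ) : Prop :=
  ∀ f : Eu N → ℝ, IsTestFunction Ω f → ∃ u : L.domain,
    ((u : L2 Ω) =ᵐ[volume.restrict Ω] GG f) ∧ (L u =ᵐ[volume.restrict Ω] f)

/-- `|x-y|^{-(N-2s)} (δ(x)/|x-y| ∧ 1)^γ (δ(y)/|x-y| ∧ 1)^γ`. -/
noncomputable def greenProfile {N : ℕ} (Ω : Set (Eu N)) (s γ : ℝ) (x y : Eu N) : ℝ :=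
  1 / ‖x - y‖ ^ ((N : ℝ) - 2 * s)
    * (min (bdist Ω x / ‖x - y‖) 1) ^ γ * (min (bdist Ω y / ‖x - y‖) 1) ^ γ

/-- `G` is a Green function of the operator `𝔾`: a Borel measurable, positive, symmetric kernel on
`(Ω × Ω) ∖ D_Ω` with the two-sided estimate of exponents `s, γ`, which represents `𝔾`. The values of
`G` elsewhere are irrelevant. -/
structure IsGreenFunction {N : ℕ} (Ω : Set (Eu N)) (s γ : ℝ)
    (GG : (Eu N → ℝ) → Eu N → ℝ) (G : Eu N → Eu N → ℝ) : Prop where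
  represents : ∀ f : Eu N → ℝ, IsTestFunction Ω f → ∀ x ∈ Ω, GG f x = ∫ y in Ω, G x y * f y
  measurable : Measurable ((offDiagonal Ω).domRestrict (Function.uncurry G))
  pos : ∀ x ∈ Ω, ∀ y ∈ Ω, x ≠ y → 0 < G x y
  symm : ∀ x ∈ Ω, ∀ y ∈ Ω, x ≠ y → G x y = G y x
  estimate : ∃ c C : ℝ, 0 < c ∧ 0 < C ∧ ∀ x ∈ Ω, ∀ y ∈ Ω, x ≠ y →
    c * greenProfile Ω s γ x y ≤ G x y ∧ G x y ≤ C * greenProfile Ω s γ x y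

/-- For all `x₀ ∈ Ω`, `z₀ ∈ ∂Ω` the limit `M(x₀, z₀)` of `G(x,y) / δ(y)^γ` as
`Ω × Ω ∋ (x,y) → (x₀,z₀)` exists, and `M : Ω × ∂Ω → [0,∞)` is continuous. -/
def HasMartinLimit {N : ℕ} (Ω : Set (Eu N)) (γ : ℝ) (G : Eu N → Eu N → ℝ) : Prop :=
  ∃ M : Eu N → Eu N → ℝ,
    (∀ x₀ ∈ Ω, ∀ z₀ ∈ frontier Ω, 0 ≤ M x₀ z₀ ∧
      Tendsto (fun p : Eu N × Eu N => G p.1 p.2 / bdist Ω p.2 ^ γ)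
        (𝓝[Ω ×ˢ Ω] (x₀, z₀)) (𝓝 (M x₀ z₀))) ∧
    ContinuousOn (Function.uncurry M) (Ω ×ˢ frontier Ω)

/-- A signed Radon measure on the open set `Ω`, given by its Jordan decomposition: two mutually
singular Borel measures carried by `Ω` and finite on the compact subsets of `Ω`. Both may have
infinite total mass. -/
structure SignedRadonMeasure {N : ℕ} (Ω : Set (Eu N)) where
  posPart : Measure (Eu N)
  negPart : Measure (Eu N)
  posPart_compl : posPart Ωᶜ = 0
  negPart_compl : negPart Ωᶜ = 0
  posPart_compact : ∀ K : Set (Eu N), IsCompact K → K ⊆ Ω → posPart K < ⊤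
  negPart_compact : ∀ K : Set (Eu N), IsCompact K → K ⊆ Ω → negPart K < ⊤
  mutuallySingular : posPart.MutuallySingular negPart

namespace SignedRadonMeasure

variable {N : ℕ} {Ω : Set (Eu N)}

/-- The total variation measure `|μ|`. -/
noncomputable def variation (μ : SignedRadonMeasure Ω) : Measure (Eu N) :=
  μ.posPart + μ.negPart

/-- The integral `∫ f dμ`, meaningful when `f` is `|μ|`-integrable. -/
noncomputable def integral (μ : SignedRadonMeasure Ω) (f : Eu N → ℝ) : ℝ :=
  (∫ y, f y ∂μ.posPart) - ∫ y, f y ∂μ.negPart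

/-- The norm `‖μ‖ = ∫_Ω δ^β d|μ|` of `𝓜(Ω, δ^β)`, with values in `[0,∞]`. The space `𝓜(Ω, δ^β)`
consists of the `μ` for which it is finite. -/
noncomputable def weightedNorm (β : ℝ) (μ : SignedRadonMeasure Ω) : ℝ≥0∞ :=
  ∫⁻ y in Ω, ENNReal.ofReal (bdist Ω y ^ β) ∂μ.variation

/-- `𝔾[μ](x) = ∫_Ω G(x,y) dμ(y)`. -/
noncomputable def green (G : Eu N → Eu N → ℝ) (μ : SignedRadonMeasure Ω) (x : Eu N) : ℝ :=
  μ.integral (G x)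

end SignedRadonMeasure

/-- The measure `δ^α dx` on `Ω`; the space `L^q(Ω, δ^α)` is the `L^q` space of this measure. -/
noncomputable def weightedVolume {N : ℕ} (Ω : Set (Eu N)) (α : ℝ) : Measure (Eu N) :=
  (volume.restrict Ω).withDensity fun x => ENNReal.ofReal (bdist Ω x ^ α)

/-- `μ ↦ 𝔾[μ]` is a compact operator from `𝓜(Ω, δ^β)` to `L^q(Ω, δ^α)`: for every `μ ∈ 𝓜(Ω, δ^β)`
the integral defining `𝔾[μ](x)` converges absolutely for a.e. `x ∈ Ω` and `𝔾[μ] ∈ L^q(Ω, δ^α)`, and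
the image of every bounded sequence has a subsequence that converges in `L^q(Ω, δ^α)`. -/
structure IsCompactGreenMap {N : ℕ} (Ω : Set (Eu N)) (G : Eu N → Eu N → ℝ) (β α q : ℝ) :
    Prop where
  integrable : ∀ μ : SignedRadonMeasure Ω, μ.weightedNorm β < ⊤ →
    ∀ᵐ x ∂(volume.restrict Ω), Integrable (G x) μ.variation
  memLp : ∀ μ : SignedRadonMeasure Ω, μ.weightedNorm β < ⊤ →
    MemLp (μ.green G) (ENNReal.ofReal q) (weightedVolume Ω α)
  compact : ∀ (μ : ℕ → SignedRadonMeasure Ω) (R : ℝ≥0∞), R < ⊤ →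
    (∀ n, (μ n).weightedNorm β ≤ R) →
    ∃ k : ℕ → ℕ, StrictMono k ∧ ∃ u : Eu N → ℝ,
      MemLp u (ENNReal.ofReal q) (weightedVolume Ω α) ∧
      Tendsto (fun n => eLpNorm (fun x => (μ (k n)).green G x - u x)
        (ENNReal.ofReal q) (weightedVolume Ω α)) atTop (𝓝 0)

/-- `max (-β-1) (β-2s) (-βN/(N-2s+β)) < α < βN/(N-2s)`. -/
def Admissible (N : ℕ) (s β α : ℝ) : Prop :=
  max (max (-β - 1) (β - 2 * s)) (-(β * N / (N - 2 * s + β))) < α ∧ α < β * N / (N - 2 * s)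

/-- The critical exponent `p*_{β,α} = (N+α)/(N+β-2s)`. -/
noncomputable def critExp (N : ℕ) (s β α : ℝ) : ℝ := (N + α) / (N + β - 2 * s)

end GreenCompactness

/-! ### Boundary collars of a `C²` domain -/

namespace GreenCompactness


variable {N : ℕ} {Ω : Set (Eu N)}

/-! Put K(x,y) = G(x,y) δ(y)^(-β) and ν = δ^β μ, so that 𝔾[μ] = ∫ K(·,y) dν(y), where ν is a finite
measure whose mass is controlled by the norm of μ. The map y ↦ K(·,y) from Ω to L^q(Ω, δ^α) is
bounded and has a limit at each point of the compact set `closure Ω`. Integrals of such a map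
against measures of bounded mass form a relatively compact set
(`exists_subseq_tendsto_integral_kernel`).

The limits in L^q follow from pointwise limits and uniform integrability
(`exists_limit_of_tendsto`). At a point of Ω the pointwise limit is the joint continuity of G. At a
boundary point, G(x,·) = O(δ^γ) forces the limit 0 when β < γ, and when β = γ the limit is the
Martin kernel of (G4).

For uniform integrability, interpolation of the upper estimate on G gives |K(x,y)|^q δ(x)^α ≤ C
δ(x)^(-a) |x-y|^(-b) with 0 ≤ a < 1 and a + b < N (`exists_exponents`). The integral of the right
side over a ball of radius ρ about y is O(ρ^(N-a-b)), uniformly in y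
(`lintegral_bdist_rpow_mul_norm_rpow_le`). This rests on the regularity of ∂Ω: the collar {δ ≤ lρ}
fills at most a fraction O(l) of a ball of radius ρ (`volume_collar`). -/

theorem measure_le_of_pairwise_translates (A : Set (Eu N)) (hA : MeasurableSet A) (w y : Eu N)
    (ρ : ℝ) (hρ : 0 < ρ) (hw : 0 < ‖w‖) (hAB : A ⊆ Metric.closedBall y ρ)
    (hdisj : ∀ x ∈ A, ∀ j : ℕ, 1 ≤ j → x + (j : ℝ) • w ∉ A) :
    volume A ≤ ENNReal.ofReal (‖w‖ / ρ * (2 * ρ) ^ N) * volume (Metric.ball (0 : Eu N) 1) := by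
  -- Packing argument: the `m + 1 > ρ / ‖w‖` translates of `A` by 0, w, ..., m w are disjoint and
  -- lie in the ball of radius 2ρ.
  set m : ℕ := ⌊ρ / ‖w‖⌋₊ with hm
  have hm1 : (m : ℝ) ≤ ρ / ‖w‖ := Nat.floor_le (by positivity)
  have hm2 : ρ / ‖w‖ < m + 1 := Nat.lt_floor_add_one _
  let T : ℕ → Set (Eu N) := fun k => (fun x => x + (-((k : ℝ) • w))) ⁻¹' A
  have hTm : ∀ k, MeasurableSet (T k) := fun k => (measurable_id.add_const _) hA
  have hTv : ∀ k, volume (T k) = volume A := fun k => measure_preimage_add_right _ _ _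
  have key : ∀ i j : ℕ, i < j → Disjoint (T i) (T j) := by
    intro i j hij
    rw [Set.disjoint_left]
    intro x hi hj
    refine hdisj _ hj (j - i) (by omega) ?_
    have : x + -((j : ℝ) • w) + ((j - i : ℕ) : ℝ) • w = x + -((i : ℝ) • w) := by
      rw [Nat.cast_sub hij.le]; module
    rw [this]; exact hi
  have hpd : (↑(Finset.range (m + 1)) : Set ℕ).PairwiseDisjoint T := by
    intro i _ j _ hij
    rcases lt_or_gt_of_ne hij with h | h
    · exact key i j h
    · exact (key j i h).symm
  have hsub : (⋃ k ∈ Finset.range (m + 1), T k) ⊆ Metric.closedBall y (2 * ρ) := by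
    intro x hx
    simp only [Finset.mem_range, mem_iUnion, exists_prop] at hx
    obtain ⟨k, hk, hx⟩ := hx
    have h1 : dist (x + -((k : ℝ) • w)) y ≤ ρ := hAB hx
    have h2 : dist x (x + -((k : ℝ) • w)) ≤ ρ := by
      rw [dist_eq_norm]
      have : x - (x + -((k : ℝ) • w)) = (k : ℝ) • w := by module
      rw [this, norm_smul, Real.norm_natCast]
      have : (k : ℝ) ≤ m := by exact_mod_cast Nat.lt_succ_iff.mp hk
      calc (k : ℝ) * ‖w‖ ≤ ρ / ‖w‖ * ‖w‖ := by gcongr; linarith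
        _ = ρ := by field_simp
    have := dist_triangle x (x + -((k : ℝ) • w)) y
    simp only [Metric.mem_closedBall]; linarith
  have h1 : ((m + 1 : ℕ) : ℝ≥0∞) * volume A ≤
      ENNReal.ofReal ((2 * ρ) ^ N) * volume (Metric.ball (0 : Eu N) 1) := by
    calc ((m + 1 : ℕ) : ℝ≥0∞) * volume A = ∑ k ∈ Finset.range (m + 1), volume (T k) := by
          simp [hTv]
      _ = volume (⋃ k ∈ Finset.range (m + 1), T k) :=
          (measure_biUnion_finset hpd fun k _ => hTm k).symm
      _ ≤ volume (Metric.closedBall y (2 * ρ)) := measure_mono hsub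
      _ = _ := by
          rw [Measure.addHaar_closedBall _ _ (by positivity)]; simp
  have h2 : (1 : ℝ≥0∞) ≤ ENNReal.ofReal (‖w‖ / ρ) * ((m + 1 : ℕ) : ℝ≥0∞) := by
    rw [← ENNReal.ofReal_natCast, ← ENNReal.ofReal_mul (by positivity), ← ENNReal.ofReal_one]
    apply ENNReal.ofReal_le_ofReal
    push_cast
    calc (1 : ℝ) = ‖w‖ / ρ * (ρ / ‖w‖) := by field_simp
      _ ≤ _ := by gcongr
  calc volume A ≤ ENNReal.ofReal (‖w‖ / ρ) * ((m + 1 : ℕ) : ℝ≥0∞) * volume A :=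
        le_mul_of_one_le_left zero_le h2
    _ ≤ ENNReal.ofReal (‖w‖ / ρ) *
        (ENNReal.ofReal ((2 * ρ) ^ N) * volume (Metric.ball (0 : Eu N) 1)) := by
        rw [mul_assoc]; gcongr
    _ = _ := by rw [ENNReal.ofReal_mul (by positivity), mul_assoc]

/-! ### The distance function and volumes of balls -/

theorem continuous_bdist (Ω : Set (Eu N)) : Continuous (bdist Ω) :=
  Metric.continuous_infDist_pt _

theorem compl_nonempty (hN : 0 < N) (hb : Bornology.IsBounded Ω) : Ωᶜ.Nonempty := by
  have : Nonempty (Fin N) := ⟨⟨0, hN⟩⟩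
  by_contra h
  rw [Set.not_nonempty_iff_eq_empty, Set.compl_empty_iff] at h
  subst h
  exact NormedSpace.unbounded_univ ℝ (Eu N) hb

theorem bdist_pos (hN : 0 < N) (ho : IsOpen Ω) (hb : Bornology.IsBounded Ω) {x : Eu N}
    (hx : x ∈ Ω) : 0 < bdist Ω x :=
  (ho.isClosed_compl.notMem_iff_infDist_pos (compl_nonempty hN hb)).mp (by simpa using hx)

theorem bdist_le_add (x y : Eu N) : bdist Ω x ≤ bdist Ω y + ‖x - y‖ := by
  rw [← dist_eq_norm]; exact Metric.infDist_le_infDist_add_dist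

theorem exists_bdist_le (hb : Bornology.IsBounded Ω) :
    ∃ D : ℝ, 0 < D ∧ (∀ x ∈ Ω, bdist Ω x ≤ D) ∧ ∀ x ∈ Ω, ∀ y ∈ Ω, ‖x - y‖ ≤ D := by
  rcases Ω.eq_empty_or_nonempty with rfl | ⟨x₀, hx₀⟩
  · exact ⟨1, one_pos, by simp, by simp⟩
  · obtain ⟨d, hd⟩ := Metric.isBounded_iff.mp hb
    have hd0 : 0 ≤ d := dist_nonneg.trans (hd hx₀ hx₀)
    refine ⟨d + bdist Ω x₀ + 1, ?_, ?_, ?_⟩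
    · have : 0 ≤ bdist Ω x₀ := Metric.infDist_nonneg
      linarith
    · intro x hx
      have := bdist_le_add (Ω := Ω) x x₀
      have h2 := hd hx hx₀
      rw [dist_eq_norm] at h2
      linarith
    · intro x hx y hy
      have h2 := hd hx hy
      rw [dist_eq_norm] at h2
      have : 0 ≤ bdist Ω x₀ := Metric.infDist_nonneg
      linarith

theorem isCompact_closure_of_bounded (hb : Bornology.IsBounded Ω) : IsCompact (closure Ω) :=
  Metric.isCompact_of_isClosed_isBounded isClosed_closure hb.closure

theorem volume_inter_closedBall_le (S : Set (Eu N)) (y : Eu N) {ρ : ℝ} (hρ : 0 ≤ ρ) :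
    volume (S ∩ Metric.closedBall y ρ) ≤
      ENNReal.ofReal (ρ ^ N) * volume (Metric.ball (0 : Eu N) 1) :=
  (measure_mono inter_subset_right).trans_eq (by
    rw [Measure.addHaar_closedBall _ _ hρ]; simp)

theorem exists_ball_one_real (N : ℕ) : ∃ V : ℝ, 0 ≤ V ∧
    volume (Metric.ball (0 : Eu N) 1) = ENNReal.ofReal V :=
  ⟨(volume (Metric.ball (0 : Eu N) 1)).toReal, ENNReal.toReal_nonneg,
    (ENNReal.ofReal_toReal measure_ball_lt_top.ne).symm⟩

/-- Near a point of the closure, collars of width `l * ρ` in balls of radius `ρ` have measure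
`O(l * ρ ^ N)`. -/
theorem local_volume_collar (hN : 0 < N) (hΩ : IsC2BoundedDomain Ω) (D : ℝ)
    {z : Eu N} (hz : z ∈ closure Ω) :
    ∃ U ∈ 𝓝 z, ∃ C : ℝ, 0 ≤ C ∧ ∀ (y : Eu N) (ρ l : ℝ), 0 < ρ → ρ ≤ D → 0 < l →
      volume (Ω ∩ U ∩ {x | bdist Ω x ≤ l * ρ} ∩ Metric.closedBall y ρ) ≤
        ENNReal.ofReal (C * l * ρ ^ N) := by
  obtain ⟨V, hV, hVe⟩ := exists_ball_one_real N
  by_cases hzΩ : z ∈ Ω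
  -- Near an interior point the collar is empty when lρ is small. Otherwise l is at least
  -- δ(z)/(2|D|) and the volume of the whole ball is already O(l ρ^N).
  · have hd := bdist_pos hN hΩ.isOpen hΩ.isBounded hzΩ
    refine ⟨{x | bdist Ω z / 2 < bdist Ω x}, ?_, 2 * |D| / bdist Ω z * V, by positivity, ?_⟩
    · exact (isOpen_lt continuous_const (continuous_bdist Ω)).mem_nhds (by simp; linarith)
    · intro y ρ l hρ hD hl
      by_cases h : l * ρ ≤ bdist Ω z / 2
      · have : Ω ∩ {x | bdist Ω z / 2 < bdist Ω x} ∩ {x | bdist Ω x ≤ l * ρ} ∩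
            Metric.closedBall y ρ = ∅ := by
          ext x; simp only [mem_inter_iff, mem_ofPred_eq, mem_empty_iff_false, iff_false]
          rintro ⟨⟨⟨_, h1⟩, h2⟩, _⟩; linarith
        rw [this]; simp
      · refine (volume_inter_closedBall_le _ _ hρ.le).trans ?_
        rw [hVe, ← ENNReal.ofReal_mul (by positivity)]
        apply ENNReal.ofReal_le_ofReal
        have : 1 ≤ 2 * |D| / bdist Ω z * l := by
          rw [div_mul_eq_mul_div, le_div_iff₀ hd]
          nlinarith [le_abs_self D]
        calc ρ ^ N * V = 1 * (V * ρ ^ N) := by ring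
          _ ≤ 2 * |D| / bdist Ω z * l * (V * ρ ^ N) := by gcongr
          _ = _ := by ring
  · have hzf : z ∈ frontier Ω := ⟨hz, by rwa [hΩ.isOpen.interior_eq]⟩
    obtain ⟨r, hr, φ, hφ, hφ0, hφΩ⟩ := hΩ.boundary z hzf
    obtain ⟨v, hv⟩ : ∃ v, 0 < fderiv ℝ φ z v := by
      by_contra! h
      apply hφ0
      ext v
      refine le_antisymm (h v) ?_
      have := h (-v)
      simp only [map_neg] at this
      simpa using this
    set g := fderiv ℝ φ z with hg
    have hv0 : 0 < ‖v‖ := norm_pos_iff.mpr (by rintro rfl; simp at hv)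
    set c := g v / 2 with hc
    have hc0 : 0 < c := by positivity
    have hs : HasStrictFDerivAt φ g z := hφ.contDiffAt.hasStrictFDerivAt (by norm_num)
    -- With error at most `c / ‖v‖` times the displacement and g v = 2c, a move by h v (h > 0)
    -- raises φ by at least c h. The same bound makes φ Lipschitz.
    have hlo := hs.isLittleO.def (c := c / ‖v‖) (by positivity)
    rw [nhds_prod_eq] at hlo
    obtain ⟨t, ht, hts⟩ := Filter.mem_prod_self_iff.mp hlo
    replace hlo : ∀ a ∈ t, ∀ b ∈ t, ‖φ a - φ b - g (a - b)‖ ≤ c / ‖v‖ * ‖a - b‖ :=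
      fun a ha b hb => hts (Set.mk_mem_prod ha hb)
    obtain ⟨r₁, hr₁, hb⟩ := Metric.mem_nhds_iff.mp ht
    -- Halved so that the point of Ωᶜ nearest to x ∈ `ball z r₂`, whose distance to x is at most |x
    -- - z|, still lies where φ is controlled.
    set r₂ := min r r₁ / 2 with hr₂
    have hr₂0 : 0 < r₂ := by positivity
    have hr2r : 2 * r₂ ≤ r := by rw [hr₂]; linarith [min_le_left r r₁]
    have hr2r1 : 2 * r₂ ≤ r₁ := by rw [hr₂]; linarith [min_le_right r r₁]
    set Lc := ‖g‖ + c / ‖v‖ with hLc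
    have hLc0 : 0 < Lc := by positivity
    have hlip : ∀ a ∈ Metric.ball z (2 * r₂), ∀ b ∈ Metric.ball z (2 * r₂),
        φ a - φ b ≤ Lc * ‖a - b‖ := by
      intro a ha b hb'
      have h1 := hlo a (hb (Metric.ball_subset_ball hr2r1 ha)) b
        (hb (Metric.ball_subset_ball hr2r1 hb'))
      rw [Real.norm_eq_abs] at h1
      have h2 := g.le_opNorm (a - b)
      rw [Real.norm_eq_abs] at h2
      have h3 := le_abs_self (φ a - φ b - g (a - b))
      have h4 := le_abs_self (g (a - b))
      rw [hLc, add_mul]; linarith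
    refine ⟨Metric.ball z r₂, Metric.ball_mem_nhds _ hr₂0, 2 * Lc * ‖v‖ / c * 2 ^ N * V,
      by positivity, ?_⟩
    intro y ρ l hρ hD hl
    -- In the collar φ ≥ -Lc l ρ, while adding w raises φ by at least 2 Lc l ρ. A collar point moved
    -- by a positive multiple of w has therefore left Ω or the ball around z, and the packing
    -- estimate applies with ‖w‖ proportional to lρ.
    set w : Eu N := (2 * Lc * (l * ρ) / c) • v with hw
    have hwn : ‖w‖ = 2 * Lc * (l * ρ) / c * ‖v‖ := by
      rw [hw, norm_smul, Real.norm_of_nonneg (by positivity)]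
    have hdist : ∀ x ∈ Ω ∩ Metric.ball z r₂, bdist Ω x ≤ l * ρ → -(Lc * (l * ρ)) ≤ φ x := by
      rintro x ⟨hx, hxb⟩ hxd
      obtain ⟨p, hp, hpd⟩ := hΩ.isOpen.isClosed_compl.exists_infDist_eq_dist
        (compl_nonempty hN hΩ.isBounded) x
      have hxz : Metric.infDist x Ωᶜ ≤ dist x z := Metric.infDist_le_dist_of_mem hzΩ
      have hxb' := Metric.mem_ball.mp hxb
      have hpb : p ∈ Metric.ball z (2 * r₂) := by
        rw [Metric.mem_ball]
        have := dist_triangle p x z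
        rw [dist_comm p x] at this
        linarith
      have hpφ : 0 ≤ φ p := by
        by_contra! h
        exact hp ((hφΩ p (Metric.ball_subset_ball hr2r hpb)).mpr h)
      have h1 := hlip p hpb x (Metric.ball_subset_ball (by linarith) hxb)
      have h2 : ‖p - x‖ ≤ l * ρ := by
        rw [← dist_eq_norm, dist_comm, ← hpd]; exact hxd
      have h3 : Lc * ‖p - x‖ ≤ Lc * (l * ρ) := by gcongr
      linarith
    have hm := measure_le_of_pairwise_translates
      (Ω ∩ Metric.ball z r₂ ∩ {x | bdist Ω x ≤ l * ρ} ∩ Metric.closedBall y ρ)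
      (((hΩ.isOpen.measurableSet.inter measurableSet_ball).inter
        (isClosed_le (continuous_bdist Ω) continuous_const).measurableSet).inter
        measurableSet_closedBall) w y ρ hρ (by rw [hwn]; positivity) inter_subset_right ?_
    · refine hm.trans ?_
      rw [hVe, ← ENNReal.ofReal_mul (by positivity)]
      apply ENNReal.ofReal_le_ofReal
      rw [hwn]
      apply le_of_eq
      rw [mul_pow]
      field_simp
    · rintro x ⟨⟨⟨hx, hxb⟩, hxd⟩, _⟩ j hj ⟨⟨⟨hx', hxb'⟩, _⟩, _⟩
      have h1 := hdist x ⟨hx, hxb⟩ hxd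
      have h2 : φ (x + (j : ℝ) • w) < 0 :=
        (hφΩ _ (Metric.ball_subset_ball (by linarith) hxb')).mp hx'
      have h3 := hlo _ (hb (Metric.ball_subset_ball (by linarith) hxb')) x
        (hb (Metric.ball_subset_ball (by linarith) hxb))
      have hj1 : (1 : ℝ) ≤ j := by exact_mod_cast hj
      set h := (j : ℝ) * (2 * Lc * (l * ρ) / c) with hh
      have hjw : x + (j : ℝ) • w - x = h • v := by rw [hw, smul_smul]; simp [hh]
      have hh0 : 2 * Lc * (l * ρ) / c ≤ h := by
        rw [hh]; exact le_mul_of_one_le_left (by positivity) hj1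
      have hhp : 0 < h := lt_of_lt_of_le (by positivity) hh0
      simp only [hjw, map_smul, norm_smul, Real.norm_eq_abs, smul_eq_mul, abs_of_pos hhp] at h3
      have h4 := neg_le_of_abs_le h3
      have h5 : c / ‖v‖ * (h * ‖v‖) = c * h := by field_simp
      have h6 : g v = 2 * c := by rw [hc]; ring
      have h7 : 2 * Lc * (l * ρ) ≤ h * c := by rwa [div_le_iff₀ hc0] at hh0
      have h8 : 0 < Lc * (l * ρ) := by positivity
      rw [h5, h6] at h4
      nlinarith

theorem volume_collar (hN : 0 < N) (hΩ : IsC2BoundedDomain Ω) (D : ℝ) :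
    ∃ C : ℝ, 0 ≤ C ∧ ∀ (y : Eu N) (ρ l : ℝ), 0 < ρ → ρ ≤ D → 0 < l →
      volume (Ω ∩ {x | bdist Ω x ≤ l * ρ} ∩ Metric.closedBall y ρ) ≤
        ENNReal.ofReal (C * l * ρ ^ N) := by
  have := (isCompact_closure_of_bounded hΩ.isBounded).induction_on
    (p := fun S => ∃ C : ℝ, 0 ≤ C ∧ ∀ (y : Eu N) (ρ l : ℝ), 0 < ρ → ρ ≤ D → 0 < l →
      volume (Ω ∩ S ∩ {x | bdist Ω x ≤ l * ρ} ∩ Metric.closedBall y ρ) ≤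
        ENNReal.ofReal (C * l * ρ ^ N))
    ⟨0, le_rfl, by simp⟩ ?_ ?_ ?_
  · simpa only [inter_eq_self_of_subset_left (subset_closure (s := Ω))] using this
  · rintro S T hST ⟨C, hC, h⟩
    exact ⟨C, hC, fun y ρ l h1 h2 h3 => (measure_mono (by gcongr)).trans (h y ρ l h1 h2 h3)⟩
  · rintro S T ⟨C, hC, h⟩ ⟨C', hC', h'⟩
    refine ⟨C + C', by positivity, fun y ρ l h1 h2 h3 => ?_⟩
    rw [add_mul, add_mul, ENNReal.ofReal_add (by positivity) (by positivity)]
    refine (measure_mono ?_).trans ((measure_union_le _ _).trans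
      (add_le_add (h y ρ l h1 h2 h3) (h' y ρ l h1 h2 h3)))
    rintro x ⟨⟨⟨a, b | b⟩, c⟩, d⟩
    · exact Or.inl ⟨⟨⟨a, b⟩, c⟩, d⟩
    · exact Or.inr ⟨⟨⟨a, b⟩, c⟩, d⟩
  · intro z hz
    obtain ⟨U, hU, C, hC, h⟩ := local_volume_collar hN hΩ D hz
    exact ⟨U, mem_nhdsWithin_of_mem_nhds hU, C, hC, h⟩

end GreenCompactness

/-! ### Integrals of `δ ^ (-a) * |x - y| ^ (-b)` -/

namespace GreenCompactness

variable {N : ℕ} {Ω : Set (Eu N)}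

/-- Truncating δ at ρ changes nothing for l < 1, and for l ≥ 1 the volume of the ball suffices.
After truncation the dyadic layers are indexed by ℕ, with no separate case for points far from the
boundary. -/
theorem volume_collar_min (hN : 0 < N) (hΩ : IsC2BoundedDomain Ω) (D : ℝ) :
    ∃ C : ℝ, 0 ≤ C ∧ ∀ (y : Eu N) (ρ l : ℝ), 0 < ρ → ρ ≤ D → 0 < l →
      volume (Ω ∩ {x | min (bdist Ω x) ρ ≤ l * ρ} ∩ Metric.closedBall y ρ) ≤
        ENNReal.ofReal (C * l * ρ ^ N) := by
  obtain ⟨C, hC, h⟩ := volume_collar hN hΩ D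
  obtain ⟨V, hV, hVe⟩ := exists_ball_one_real N
  refine ⟨C + V, by positivity, fun y ρ l h1 h2 h3 => ?_⟩
  by_cases hl : l < 1
  · refine (measure_mono ?_).trans ((h y ρ l h1 h2 h3).trans (ENNReal.ofReal_le_ofReal ?_))
    · rintro x ⟨⟨hx, hx1⟩, hx2⟩
      refine ⟨⟨hx, ?_⟩, hx2⟩
      replace hx1 : min (bdist Ω x) ρ ≤ l * ρ := hx1
      rcases min_le_iff.mp hx1 with h4 | h4
      · exact h4
      · nlinarith
    · gcongr; linarith
  · refine (volume_inter_closedBall_le _ _ h1.le).trans ?_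
    rw [hVe, ← ENNReal.ofReal_mul (by positivity)]
    apply ENNReal.ofReal_le_ofReal
    push Not at hl
    calc ρ ^ N * V = V * 1 * ρ ^ N := by ring
      _ ≤ _ := by gcongr; linarith

/-- Weight times volume of a dyadic cell, k indexing the scale of |x - y| and j that of δ relative
to it. The result is geometric in both indices: summability over j amounts to a < 1 and over k to a
+ b < N. -/
theorem dyadic_term_eq {a b ρ V : ℝ} (hρ : 0 < ρ) (N j k : ℕ) :
    ((1 / 2 : ℝ) ^ (j + 1) * ((1 / 2) ^ k * ρ)) ^ (-a) * ((1 / 2) ^ (k + 1) * ρ) ^ (-b) *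
      (V * (1 / 2) ^ j * ((1 / 2) ^ k * ρ) ^ N) =
    V * (1 / 2 : ℝ) ^ (-a) * (1 / 2 : ℝ) ^ (-b) * ρ ^ ((N : ℝ) - a - b) *
      ((1 / 2 : ℝ) ^ ((N : ℝ) - a - b)) ^ k * ((1 / 2 : ℝ) ^ (1 - a)) ^ j := by
  set h : ℝ := 1 / 2 with hh
  have h0 : 0 < h := by norm_num [hh]
  set R : ℝ := h ^ k * ρ with hR
  have hR0 : 0 < R := by positivity
  have e1 : (h ^ (j + 1) * R) ^ (-a) = (h ^ j) ^ (-a) * h ^ (-a) * R ^ (-a) := by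
    rw [Real.mul_rpow (by positivity) hR0.le, pow_succ, Real.mul_rpow (by positivity) h0.le]
  have e2 : (h ^ (k + 1) * ρ) ^ (-b) = h ^ (-b) * R ^ (-b) := by
    rw [← Real.mul_rpow h0.le hR0.le, hR, pow_succ]; ring_nf
  have e3 : R ^ N * R ^ (-a) * R ^ (-b) = ρ ^ ((N : ℝ) - a - b) * (h ^ ((N : ℝ) - a - b)) ^ k := by
    rw [← Real.rpow_natCast R, ← Real.rpow_add hR0, ← Real.rpow_add hR0, hR,
      Real.mul_rpow (by positivity) hρ.le, ← Real.rpow_natCast h k, ← Real.rpow_mul h0.le,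
      ← Real.rpow_natCast _ k, ← Real.rpow_mul h0.le, mul_comm (k : ℝ), mul_comm]
    ring_nf
  have e4 : h ^ j * (h ^ j) ^ (-a) = (h ^ (1 - a)) ^ j := by
    rw [← Real.rpow_natCast h j, ← Real.rpow_mul h0.le, ← Real.rpow_add h0,
      ← Real.rpow_natCast _ j, ← Real.rpow_mul h0.le]
    ring_nf
  rw [e1, e2, ← e4]
  calc _ = V * h ^ (-a) * h ^ (-b) * (R ^ N * R ^ (-a) * R ^ (-b)) * (h ^ j * (h ^ j) ^ (-a)) := by
        ring
    _ = _ := by rw [e3]; ring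

theorem lintegral_bdist_rpow_mul_norm_rpow_le (hN : 0 < N) (hΩ : IsC2BoundedDomain Ω) (D : ℝ)
    {a b : ℝ} (ha : 0 ≤ a) (ha1 : a < 1) (hb : 0 ≤ b) (hab : a + b < N) :
    ∃ C : ℝ, 0 ≤ C ∧ ∀ (y : Eu N) (ρ : ℝ), 0 < ρ → ρ ≤ D →
      ∫⁻ x in Ω ∩ Metric.closedBall y ρ, ENNReal.ofReal (bdist Ω x ^ (-a) * ‖x - y‖ ^ (-b)) ≤
        ENNReal.ofReal (C * ρ ^ ((N : ℝ) - a - b)) := by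
  have : Nonempty (Fin N) := ⟨⟨0, hN⟩⟩
  obtain ⟨V, hV, hvol⟩ := volume_collar_min hN hΩ D
  set A : ℝ := (1 / 2) ^ (1 - a) with hA
  set B : ℝ := (1 / 2) ^ ((N : ℝ) - a - b) with hB
  have hA0 : 0 ≤ A := by positivity
  have hB0 : 0 ≤ B := by positivity
  have hA1 : A < 1 := Real.rpow_lt_one (by norm_num) (by norm_num) (by linarith)
  have hB1 : B < 1 := Real.rpow_lt_one (by norm_num) (by norm_num) (by linarith)
  refine ⟨V * (1 / 2) ^ (-a) * (1 / 2) ^ (-b) * (1 - B)⁻¹ * (1 - A)⁻¹, ?_, fun y ρ hρ hD => ?_⟩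
  · have := sub_pos.mpr hA1
    have := sub_pos.mpr hB1
    positivity
  -- The cells are bounded on one side only and overlap; an upper bound requires only that they
  -- cover, since the indicator sums are nonnegative.
  let E : ℕ → ℕ → Set (Eu N) := fun k j =>
    Ω ∩ {x | min (bdist Ω x) ((1 / 2) ^ k * ρ) ≤ (1 / 2) ^ j * ((1 / 2) ^ k * ρ)} ∩
      Metric.closedBall y ((1 / 2) ^ k * ρ)
  let w : ℕ → ℕ → ℝ := fun k j =>
    ((1 / 2 : ℝ) ^ (j + 1) * ((1 / 2) ^ k * ρ)) ^ (-a) * ((1 / 2) ^ (k + 1) * ρ) ^ (-b)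
  have hE : ∀ k j, MeasurableSet (E k j) := fun k j =>
    (hΩ.isOpen.measurableSet.inter (isClosed_le ((continuous_bdist Ω).min continuous_const)
      continuous_const).measurableSet).inter measurableSet_closedBall
  have hpt : ∀ x ∈ Ω ∩ Metric.closedBall y ρ, x ≠ y →
      ENNReal.ofReal (bdist Ω x ^ (-a) * ‖x - y‖ ^ (-b)) ≤
        ∑' k, ∑' j, (E k j).indicator (fun _ => ENNReal.ofReal (w k j)) x := by
    rintro x ⟨hx, hxy⟩ hne
    have hr0 : 0 < ‖x - y‖ := norm_pos_iff.mpr (sub_ne_zero.mpr hne)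
    have hr1 : ‖x - y‖ ≤ ρ := by rwa [← dist_eq_norm]
    have hd := bdist_pos hN hΩ.isOpen hΩ.isBounded hx
    obtain ⟨k, hk1, hk2⟩ := exists_nat_pow_near_of_lt_one (x := ‖x - y‖ / ρ) (y := (1 / 2 : ℝ))
      (by positivity) ((div_le_one hρ).mpr hr1) (by norm_num) (by norm_num)
    rw [lt_div_iff₀ hρ] at hk1
    rw [div_le_iff₀ hρ] at hk2
    set R : ℝ := (1 / 2) ^ k * ρ with hR
    have hR0 : 0 < R := by positivity
    obtain ⟨j, hj1, hj2⟩ := exists_nat_pow_near_of_lt_one (x := min (bdist Ω x) R / R)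
      (y := (1 / 2 : ℝ)) (by positivity) ((div_le_one hR0).mpr (min_le_right _ _))
      (by norm_num) (by norm_num)
    rw [lt_div_iff₀ hR0] at hj1
    rw [div_le_iff₀ hR0] at hj2
    have hmem : x ∈ E k j := ⟨⟨hx, hj2⟩, by rw [Metric.mem_closedBall, dist_eq_norm]; exact hk2⟩
    calc ENNReal.ofReal (bdist Ω x ^ (-a) * ‖x - y‖ ^ (-b)) ≤ ENNReal.ofReal (w k j) := by
          apply ENNReal.ofReal_le_ofReal
          have h1 : bdist Ω x ^ (-a) ≤ ((1 / 2 : ℝ) ^ (j + 1) * R) ^ (-a) :=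
            Real.rpow_le_rpow_of_nonpos (by positivity)
              (hj1.le.trans (min_le_left _ _)) (by linarith)
          have h2 : ‖x - y‖ ^ (-b) ≤ ((1 / 2 : ℝ) ^ (k + 1) * ρ) ^ (-b) :=
            Real.rpow_le_rpow_of_nonpos (by positivity) hk1.le (by linarith)
          exact mul_le_mul h1 h2 (by positivity) (by positivity)
      _ = (E k j).indicator (fun _ => ENNReal.ofReal (w k j)) x := by
          rw [indicator_of_mem hmem]
      _ ≤ ∑' j, (E k j).indicator (fun _ => ENNReal.ofReal (w k j)) x :=
          ENNReal.le_tsum (f := fun j => (E k j).indicator (fun _ => ENNReal.ofReal (w k j)) x) j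
      _ ≤ _ := ENNReal.le_tsum
          (f := fun k => ∑' j, (E k j).indicator (fun _ => ENNReal.ofReal (w k j)) x) k
  set Q : ℝ := V * (1 / 2) ^ (-a) * (1 / 2) ^ (-b) * ρ ^ ((N : ℝ) - a - b) with hQ
  have hQ0 : 0 ≤ Q := by positivity
  calc ∫⁻ x in Ω ∩ Metric.closedBall y ρ, ENNReal.ofReal (bdist Ω x ^ (-a) * ‖x - y‖ ^ (-b))
      ≤ ∫⁻ x in Ω ∩ Metric.closedBall y ρ,
          ∑' k, ∑' j, (E k j).indicator (fun _ => ENNReal.ofReal (w k j)) x := by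
        apply lintegral_mono_ae
        have hne : ∀ᵐ x ∂(volume : Measure (Eu N)), x ≠ y := by
          simp [ae_iff]
        filter_upwards [ae_restrict_mem
          (hΩ.isOpen.measurableSet.inter measurableSet_closedBall),
          ae_restrict_of_ae hne] with x h1 h2 using hpt x h1 h2
    _ ≤ ∫⁻ x, ∑' k, ∑' j, (E k j).indicator (fun _ => ENNReal.ofReal (w k j)) x :=
        setLIntegral_le_lintegral _ _
    _ = ∑' k, ∑' j, ENNReal.ofReal (w k j) * volume (E k j) := by
        rw [lintegral_tsum fun k => (Measurable.tsum fun j =>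
          measurable_const.indicator (hE k j)).aemeasurable]
        congr 1; ext k
        rw [lintegral_tsum fun j => (measurable_const.indicator (hE k j)).aemeasurable]
        congr 1; ext j
        rw [lintegral_indicator_const (hE k j)]
    _ ≤ ∑' k, ∑' j, ENNReal.ofReal Q * ENNReal.ofReal B ^ k * ENNReal.ofReal A ^ j := by
        refine ENNReal.tsum_le_tsum fun k => ENNReal.tsum_le_tsum fun j => ?_
        have hle : (1 / 2 : ℝ) ^ k * ρ ≤ D :=
          (mul_le_of_le_one_left hρ.le (pow_le_one₀ (by norm_num) (by norm_num))).trans hD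
        refine (mul_le_mul_right (hvol y ((1 / 2) ^ k * ρ) ((1 / 2) ^ j) (by positivity) hle
          (by positivity)) _).trans_eq ?_
        rw [← ENNReal.ofReal_mul (by positivity), dyadic_term_eq hρ, ← ENNReal.ofReal_pow hB0,
          ← ENNReal.ofReal_pow hA0, ← ENNReal.ofReal_mul hQ0, ← ENNReal.ofReal_mul (by positivity)]
    _ = ENNReal.ofReal Q * (1 - ENNReal.ofReal B)⁻¹ * (1 - ENNReal.ofReal A)⁻¹ := by
        simp_rw [ENNReal.tsum_mul_left, ENNReal.tsum_mul_right, ENNReal.tsum_mul_left,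
          ENNReal.tsum_geometric]
    _ = _ := by
        have hA2 := sub_pos.mpr hA1
        have hB2 := sub_pos.mpr hB1
        rw [← ENNReal.ofReal_one, ← ENNReal.ofReal_sub _ hB0, ← ENNReal.ofReal_sub _ hA0,
          ← ENNReal.ofReal_inv_of_pos hB2, ← ENNReal.ofReal_inv_of_pos hA2,
          ← ENNReal.ofReal_mul hQ0, ← ENNReal.ofReal_mul (by positivity)]
        congr 1; rw [hQ]; ring

end GreenCompactness

/-! ### Pointwise bounds for the Green profile -/

namespace GreenCompactness

/-- Here r, dx, dy stand for |x-y|, δ(x), δ(y). The parameter θ trades powers of δ(x) against powers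
of r, while the factor δ(y)^(-β) is absorbed by (δ(y)/r ∧ 1)^γ. Negative θ spends the decay in δ(x);
positive θ uses that δ(x) is comparable to at most δ(y) + r. -/
theorem profile_le {n β γ θ r dx dy : ℝ} (hr : 0 < r) (hx : 0 < dx) (hy : 0 < dy)
    (hxy : dx ≤ dy + r) (hβ : 0 ≤ β) (hβγ : β ≤ γ) (hθ1 : -γ ≤ θ) (hθ2 : θ ≤ β) :
    1 / r ^ n * (min (dx / r) 1) ^ γ * (min (dy / r) 1) ^ γ * dy ^ (-β) ≤
      2 ^ γ * (r ^ (-(n + β - θ)) * dx ^ (-θ)) := by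
  set A := min (dx / r) 1 with hA
  set B := min (dy / r) 1 with hB
  have hA0 : 0 < A := by positivity
  have hB0 : 0 < B := by positivity
  have hA1 : A ≤ 1 := min_le_right _ _
  have hB1 : B ≤ 1 := min_le_right _ _
  have hγ : 0 ≤ γ := hβ.trans hβγ
  have e0 : 1 / r ^ n = r ^ (-n) := by rw [Real.rpow_neg hr.le, one_div]
  have h2 : (1 : ℝ) ≤ 2 ^ γ := Real.one_le_rpow (by norm_num) hγ
  have hBβ : B ^ γ ≤ B ^ β := Real.rpow_le_rpow_of_exponent_ge hB0 hB1 hβγ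
  rw [e0]
  rcases le_total θ 0 with hθ | hθ
  · have h3 : A ^ γ ≤ dx ^ (-θ) * r ^ θ := by
      calc A ^ γ ≤ A ^ (-θ) := Real.rpow_le_rpow_of_exponent_ge hA0 hA1 (by linarith)
        _ ≤ (dx / r) ^ (-θ) := Real.rpow_le_rpow hA0.le (min_le_left _ _) (by linarith)
        _ = _ := by rw [Real.div_rpow hx.le hr.le, Real.rpow_neg hr.le θ, div_inv_eq_mul]
    have h4 : B ^ γ ≤ dy ^ β * r ^ (-β) := by
      calc B ^ γ ≤ B ^ β := hBβ
        _ ≤ (dy / r) ^ β := Real.rpow_le_rpow hB0.le (min_le_left _ _) hβ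
        _ = _ := by rw [Real.div_rpow hy.le hr.le, Real.rpow_neg hr.le β, div_eq_mul_inv]
    calc r ^ (-n) * A ^ γ * B ^ γ * dy ^ (-β)
        ≤ r ^ (-n) * (dx ^ (-θ) * r ^ θ) * (dy ^ β * r ^ (-β)) * dy ^ (-β) := by gcongr
      _ = (r ^ (-n) * r ^ θ * r ^ (-β)) * dx ^ (-θ) * (dy ^ β * dy ^ (-β)) := by ring
      _ = 1 * (r ^ (-(n + β - θ)) * dx ^ (-θ)) := by
          rw [← Real.rpow_add hr, ← Real.rpow_add hr, ← Real.rpow_add hy]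
          simp only [add_neg_cancel, Real.rpow_zero, mul_one, one_mul]
          ring_nf
      _ ≤ _ := by gcongr
  · have h3 : A ^ γ ≤ 1 := Real.rpow_le_one hA0.le hA1 hγ
    -- If r ≤ dy then dx ≤ 2 dy and B ≤ 1; if dy ≤ r then dx ≤ 2r and B ≤ dy / r.
    have hB2 : B ≤ 2 * dy / dx := by
      rw [le_div_iff₀ hx]
      rcases le_total r dy with h | h
      · nlinarith
      · have : B ≤ dy / r := min_le_left _ _
        calc B * dx ≤ dy / r * (2 * r) := by gcongr; linarith
          _ = 2 * dy := by field_simp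
    have h4 : B ^ γ ≤ (dy ^ (β - θ) * r ^ (-(β - θ))) * (2 ^ γ * dy ^ θ * dx ^ (-θ)) := by
      calc B ^ γ ≤ B ^ β := hBβ
        _ = B ^ (β - θ) * B ^ θ := by rw [← Real.rpow_add hB0]; ring_nf
        _ ≤ (dy / r) ^ (β - θ) * (2 * dy / dx) ^ θ := by
            exact mul_le_mul (Real.rpow_le_rpow hB0.le (min_le_left _ _) (by linarith))
              (Real.rpow_le_rpow hB0.le hB2 hθ) (by positivity) (by positivity)
        _ = (dy ^ (β - θ) * r ^ (-(β - θ))) * (2 ^ θ * dy ^ θ * dx ^ (-θ)) := by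
            rw [Real.div_rpow hy.le hr.le, Real.div_rpow (by positivity) hx.le,
              Real.mul_rpow (by norm_num) hy.le, Real.rpow_neg hr.le, Real.rpow_neg hx.le]
            ring
        _ ≤ _ := by
            gcongr
            · norm_num
            · linarith
    calc r ^ (-n) * A ^ γ * B ^ γ * dy ^ (-β)
        ≤ r ^ (-n) * 1 * ((dy ^ (β - θ) * r ^ (-(β - θ))) * (2 ^ γ * dy ^ θ * dx ^ (-θ))) *
          dy ^ (-β) := by gcongr
      _ = 2 ^ γ * ((r ^ (-n) * r ^ (-(β - θ))) * dx ^ (-θ)) *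
          (dy ^ (β - θ) * dy ^ θ * dy ^ (-β)) := by ring
      _ = _ := by
          rw [← Real.rpow_add hr, ← Real.rpow_add hy, ← Real.rpow_add hy]
          have : β - θ + θ + -β = 0 := by ring
          rw [this, Real.rpow_zero, mul_one]
          ring_nf

theorem profile_rpow_mul_le {n α β γ θ q r dx dy : ℝ} (hq : 0 ≤ q) (hr : 0 < r) (hx : 0 < dx)
    (hy : 0 < dy) (hxy : dx ≤ dy + r) (hβ : 0 ≤ β) (hβγ : β ≤ γ) (hθ1 : -γ ≤ θ) (hθ2 : θ ≤ β) :
    (1 / r ^ n * (min (dx / r) 1) ^ γ * (min (dy / r) 1) ^ γ * dy ^ (-β)) ^ q * dx ^ α ≤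
      (2 ^ γ) ^ q * (dx ^ (α - q * θ) * r ^ (-(q * (n + β - θ)))) := by
  calc _ ≤ (2 ^ γ * (r ^ (-(n + β - θ)) * dx ^ (-θ))) ^ q * dx ^ α := by
        refine mul_le_mul_of_nonneg_right (Real.rpow_le_rpow (by positivity)
          (profile_le hr hx hy hxy hβ hβγ hθ1 hθ2) hq) (by positivity)
    _ = (2 ^ γ) ^ q * ((dx ^ (-θ * q) * dx ^ α) * r ^ (-(n + β - θ) * q)) := by
        rw [Real.mul_rpow (by positivity) (by positivity),
          Real.mul_rpow (by positivity) (by positivity), ← Real.rpow_mul hr.le,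
          ← Real.rpow_mul hx.le]
        ring
    _ = _ := by
        rw [← Real.rpow_add hx]
        ring_nf

/-- The weighted power of the normalised profile is dominated by `δ ^ (-a) * |x - y| ^ (-b)` with
exponents for which this is uniformly integrable. -/
theorem exists_exponents {N : ℕ} {s γ β α q D : ℝ} (hN : 2 * s < (N : ℝ))
    (hβ : 0 ≤ β) (hβγ : β ≤ γ) (hα : Admissible N s β α) (hq : 1 ≤ q) (hq2 : q < critExp N s β α)
    (hD : 0 < D) :
    ∃ a b C : ℝ, 0 ≤ a ∧ a < 1 ∧ 0 ≤ b ∧ a + b < N ∧ 0 ≤ C ∧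
      ∀ r dx dy : ℝ, 0 < r → 0 < dx → 0 < dy → dx ≤ D → dx ≤ dy + r →
        (1 / r ^ ((N : ℝ) - 2 * s) * (min (dx / r) 1) ^ γ * (min (dy / r) 1) ^ γ * dy ^ (-β)) ^ q *
          dx ^ α ≤ C * (dx ^ (-a) * r ^ (-b)) := by
  obtain ⟨hα1, hα2⟩ := hα
  have hα3 : -β - 1 < α := lt_of_le_of_lt (by simp) hα1
  have hn : 0 < (N : ℝ) - 2 * s := by linarith
  have hq0 : 0 < q := by linarith
  rw [critExp, lt_div_iff₀ (by linarith)] at hq2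
  rw [lt_div_iff₀ hn] at hα2
  -- The choice is θ = α/q, which cancels δ(x) altogether, clipped to the allowed range [-γ, β].
  -- Here it is clipped at β and the remaining nonnegative power of δ(x) is bounded by a power of D;
  -- b < N is where the upper bound on α enters.
  by_cases h1 : q * β ≤ α
  · refine ⟨0, q * (N - 2 * s), (2 ^ γ) ^ q * D ^ (α - q * β), le_rfl, one_pos, by positivity, ?_,
      by positivity, ?_⟩
    · by_contra! h
      nlinarith [mul_le_mul_of_nonneg_left h hβ, mul_le_mul_of_nonneg_right h1 hn.le]
    · intro r dx dy hr hx hy hxD hxy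
      refine (profile_rpow_mul_le (θ := β) hq0.le hr hx hy hxy hβ hβγ (by linarith) le_rfl).trans ?_
      rw [neg_zero, Real.rpow_zero, one_mul, ← mul_assoc, add_sub_cancel_right]
      gcongr
  · push Not at h1
    -- No clipping: b = q(N - 2s + β) - α, which is less than N exactly when q is below the critical
    -- exponent.
    by_cases h2 : -(q * γ) ≤ α
    · refine ⟨0, q * (N - 2 * s + β - α / q), (2 ^ γ) ^ q, le_rfl, one_pos, ?_, ?_,
        by positivity, ?_⟩
      · have : α / q ≤ β := by rw [div_le_iff₀ hq0]; linarith
        have : 0 ≤ (N : ℝ) - 2 * s + β - α / q := by linarith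
        positivity
      · have : q * (N - 2 * s + β - α / q) = q * (N - 2 * s + β) - α := by field_simp
        linarith
      · intro r dx dy hr hx hy hxD hxy
        refine (profile_rpow_mul_le (α := α) (θ := α / q) hq0.le hr hx hy hxy hβ hβγ ?_ ?_).trans_eq
          ?_
        · rw [le_div_iff₀ hq0]; linarith
        · rw [div_le_iff₀ hq0]; linarith
        · rw [mul_div_cancel₀ _ hq0.ne', sub_self, neg_zero]
    · push Not at h2
      -- Clipped at -γ: a negative power of δ(x) survives. It has a < 1 because α > -β - 1 and β ≤ γ
      -- ≤ qγ, and a + b is again q(N - 2s + β) - α.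
      refine ⟨-(α + q * γ), q * (N - 2 * s + β + γ), (2 ^ γ) ^ q, by linarith, by nlinarith, ?_,
        by linarith, by positivity, ?_⟩
      · have : 0 ≤ (N : ℝ) - 2 * s + β + γ := by linarith
        positivity
      · intro r dx dy hr hx hy hxD hxy
        refine (profile_rpow_mul_le (θ := -γ) hq0.le hr hx hy hxy hβ hβγ le_rfl
          (by linarith)).trans_eq ?_
        ring_nf

end GreenCompactness

/-! ### Compactness of integral operators on finite measures -/

namespace GreenCompactness

section IntegralOperators

theorem aestronglyMeasurable_integral_kernel {X Y : Type*} [MeasurableSpace X]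
    [MeasurableSpace Y] {m : Measure X} {K : X → Y → ℝ} (hK : Measurable (Function.uncurry K))
    (ν : Measure Y) [SFinite ν] : AEStronglyMeasurable (fun x => ∫ y, K x y ∂ν) m :=
  (hK.stronglyMeasurable.integral_prod_right (ν := ν)).aestronglyMeasurable

variable {X Y : Type*} [MeasurableSpace X] [MeasurableSpace Y] {m : Measure X} [SFinite m]
  {p : ℝ≥0∞} {K : X → Y → ℝ}

/-- Hölder's inequality in y against the finite measure ν, followed by Tonelli. -/
theorem lintegral_lintegral_enorm_rpow_le {ν : Measure Y} [IsFiniteMeasure ν] (hp1 : 1 ≤ p)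
    (hp : p ≠ ⊤) (hK : Measurable (Function.uncurry K)) {ε : ℝ≥0∞}
    (hε : ∀ᵐ y ∂ν, eLpNorm (fun x => K x y) p m ≤ ε) :
    ∫⁻ x, (∫⁻ y, ‖K x y‖ₑ ∂ν) ^ p.toReal ∂m ≤ (ε * ν univ) ^ p.toReal := by
  have hp0 : p ≠ 0 := (one_pos.trans_le hp1).ne'
  set q := p.toReal with hq
  have hq1 : 1 ≤ q := by rw [hq, ← ENNReal.toReal_one]; exact ENNReal.toReal_mono hp hp1
  have hq0 : 0 < q := by linarith
  have hpt : ∀ x, (∫⁻ y, ‖K x y‖ₑ ∂ν) ^ q ≤ ν univ ^ (q - 1) * ∫⁻ y, ‖K x y‖ₑ ^ q ∂ν := by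
    intro x
    have h1 := eLpNorm_le_eLpNorm_mul_rpow_measure_univ (μ := ν) hp1
      (hK.of_uncurry_left (x := x)).aestronglyMeasurable
    rw [eLpNorm_one_eq_lintegral_enorm, eLpNorm_eq_lintegral_rpow_enorm_toReal hp0 hp] at h1
    calc _ ≤ _ := ENNReal.rpow_le_rpow h1 hq0.le
      _ = _ := by
        rw [ENNReal.mul_rpow_of_nonneg _ _ hq0.le, ← ENNReal.rpow_mul, ← ENNReal.rpow_mul, ← hq,
          ENNReal.toReal_one, one_div_mul_cancel hq0.ne', ENNReal.rpow_one, mul_comm]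
        congr 2
        field_simp
  calc ∫⁻ x, (∫⁻ y, ‖K x y‖ₑ ∂ν) ^ q ∂m
      ≤ ∫⁻ x, ν univ ^ (q - 1) * ∫⁻ y, ‖K x y‖ₑ ^ q ∂ν ∂m := lintegral_mono hpt
    _ = ν univ ^ (q - 1) * ∫⁻ y, ∫⁻ x, ‖K x y‖ₑ ^ q ∂m ∂ν := by
        have hm : Measurable (Function.uncurry fun x y => ‖K x y‖ₑ ^ q) :=
          (hK.enorm).pow_const q
        have hm' : Measurable fun x => ∫⁻ y, ‖K x y‖ₑ ^ q ∂ν := hm.lintegral_prod_right'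
        rw [lintegral_const_mul _ hm', lintegral_lintegral_swap hm.aemeasurable]
    _ ≤ ν univ ^ (q - 1) * ∫⁻ y, ε ^ q ∂ν := by
        refine mul_le_mul_right (lintegral_mono_ae ?_) _
        filter_upwards [hε] with y hy
        rw [eLpNorm_eq_lintegral_rpow_enorm_toReal hp0 hp, ← hq] at hy
        calc ∫⁻ x, ‖K x y‖ₑ ^ q ∂m = ((∫⁻ x, ‖K x y‖ₑ ^ q ∂m) ^ (1 / q)) ^ q := by
              rw [← ENNReal.rpow_mul, one_div_mul_cancel hq0.ne', ENNReal.rpow_one]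
          _ ≤ ε ^ q := ENNReal.rpow_le_rpow hy hq0.le
    _ = (ε * ν univ) ^ q := by
        rw [lintegral_const, ENNReal.mul_rpow_of_nonneg _ _ hq0.le, ← mul_assoc, mul_comm _ (ε ^ q),
          mul_assoc]
        congr 1
        conv_lhs => rw [← ENNReal.rpow_one (ν univ), ← ENNReal.rpow_mul, one_mul]
        rw [← ENNReal.rpow_add_of_nonneg _ _ (by linarith) zero_le_one, sub_add_cancel]

/-- A form of Minkowski's integral inequality. -/
theorem eLpNorm_integral_le {ν : Measure Y} [IsFiniteMeasure ν] (hp1 : 1 ≤ p)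
    (hp : p ≠ ⊤) (hK : Measurable (Function.uncurry K)) {ε : ℝ≥0∞}
    (hε : ∀ᵐ y ∂ν, eLpNorm (fun x => K x y) p m ≤ ε) :
    eLpNorm (fun x => ∫ y, K x y ∂ν) p m ≤ ε * ν univ := by
  have hp0 : p ≠ 0 := (one_pos.trans_le hp1).ne'
  have hq0 : 0 < p.toReal := ENNReal.toReal_pos hp0 hp
  rw [eLpNorm_eq_lintegral_rpow_enorm_toReal hp0 hp]
  calc _ ≤ (∫⁻ x, (∫⁻ y, ‖K x y‖ₑ ∂ν) ^ p.toReal ∂m) ^ (1 / p.toReal) := by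
        gcongr with x
        exact enorm_integral_le_lintegral_enorm _
    _ ≤ ((ε * ν univ) ^ p.toReal) ^ (1 / p.toReal) := by
        gcongr
        exact lintegral_lintegral_enorm_rpow_le hp1 hp hK hε
    _ = _ := by rw [← ENNReal.rpow_mul, mul_one_div_cancel hq0.ne', ENNReal.rpow_one]

theorem ae_integrable_of_eLpNorm_le {ν : Measure Y} [IsFiniteMeasure ν] (hp1 : 1 ≤ p)
    (hp : p ≠ ⊤) (hK : Measurable (Function.uncurry K)) {ε : ℝ≥0∞} (hε' : ε < ⊤)
    (hε : ∀ᵐ y ∂ν, eLpNorm (fun x => K x y) p m ≤ ε) :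
    ∀ᵐ x ∂m, Integrable (K x) ν := by
  have hp0 : p ≠ 0 := (one_pos.trans_le hp1).ne'
  have hq0 : 0 < p.toReal := ENNReal.toReal_pos hp0 hp
  have h1 := lintegral_lintegral_enorm_rpow_le hp1 hp hK hε
  have h2 : ∫⁻ x, (∫⁻ y, ‖K x y‖ₑ ∂ν) ^ p.toReal ∂m ≠ ⊤ :=
    ne_top_of_le_ne_top (ENNReal.rpow_ne_top_of_nonneg hq0.le
      (ENNReal.mul_ne_top hε'.ne (measure_ne_top _ _))) h1
  have h3 : Measurable fun x => (∫⁻ y, ‖K x y‖ₑ ∂ν) ^ p.toReal :=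
    (Measurable.lintegral_prod_right' (f := fun z : X × Y => ‖K z.1 z.2‖ₑ) hK.enorm).pow_const _
  filter_upwards [ae_lt_top h3 h2] with x hx
  refine ⟨(hK.of_uncurry_left (x := x)).aestronglyMeasurable, ?_⟩
  exact (ENNReal.rpow_lt_top_iff_of_pos hq0).mp hx

theorem memLp_integral_kernel {ν : Measure Y} [IsFiniteMeasure ν] (hp1 : 1 ≤ p)
    (hp : p ≠ ⊤) (hK : Measurable (Function.uncurry K)) {ε : ℝ≥0∞} (hε' : ε < ⊤)
    (hε : ∀ᵐ y ∂ν, eLpNorm (fun x => K x y) p m ≤ ε) :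
    MemLp (fun x => ∫ y, K x y ∂ν) p m :=
  ⟨aestronglyMeasurable_integral_kernel hK ν,
    (eLpNorm_integral_le hp1 hp hK hε).trans_lt (ENNReal.mul_lt_top hε' (measure_lt_top _ _))⟩

variable [TopologicalSpace Y] [OpensMeasurableSpace Y] {Ω S : Set Y}

-- Local approximation is patched together by compactness of S. The error is proportional to ν(S'),
-- so it does not grow with the number of patches, and one compact set 𝒦 serves all ν of mass at
-- most R. The larger set S' is present because S need not be measurable.
open scoped Pointwise in
theorem exists_isCompact_approx [Fact (1 ≤ p)] (hp : p ≠ ⊤) (hK : Measurable (Function.uncurry K))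
    {B : ℝ≥0∞} (hB : B < ⊤) (hKB : ∀ y ∈ Ω, eLpNorm (fun x => K x y) p m ≤ B) (hS : IsCompact S)
    (hlim : ∀ z ∈ S, ∃ k : X → ℝ, Measurable k ∧ MemLp k p m ∧
      Tendsto (fun y => eLpNorm (fun x => K x y - k x) p m) (𝓝[Ω] z) (𝓝 0))
    {R : ℝ} (hR : 0 ≤ R) {ε : ℝ≥0∞} (hε : 0 < ε) :
    ∃ 𝒦 : Set (Lp ℝ p m), IsCompact 𝒦 ∧ ∃ S' : Set Y, S ⊆ S' ∧ MeasurableSet S' ∧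
      ∀ ν : Measure Y, IsFiniteMeasure ν → ν Ωᶜ = 0 → ν univ ≤ ENNReal.ofReal R →
        ∃ w ∈ 𝒦, eLpNorm (fun x => ∫ y in S', K x y ∂ν - w x) p m ≤ ε * ν S' := by
  have hp1 : 1 ≤ p := Fact.out
  have hae : ∀ ν : Measure Y, ν Ωᶜ = 0 → ∀ᵐ y ∂ν, y ∈ Ω := fun ν h => by rwa [ae_iff]
  refine hS.induction_on (p := fun S => ∃ 𝒦 : Set (Lp ℝ p m), IsCompact 𝒦 ∧ ∃ S' : Set Y, S ⊆ S' ∧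
      MeasurableSet S' ∧ ∀ ν : Measure Y, IsFiniteMeasure ν → ν Ωᶜ = 0 → ν univ ≤ ENNReal.ofReal R →
        ∃ w ∈ 𝒦, eLpNorm (fun x => ∫ y in S', K x y ∂ν - w x) p m ≤ ε * ν S') ?_ ?_ ?_ ?_
  · refine ⟨{0}, isCompact_singleton, ∅, subset_rfl, MeasurableSet.empty, fun ν _ _ _ =>
      ⟨0, rfl, ?_⟩⟩
    refine le_of_eq_of_le ?_ zero_le
    rw [← eLpNorm_zero (α := X) (ε := ℝ) (p := p) (μ := m)]
    apply eLpNorm_congr_ae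
    filter_upwards [Lp.coeFn_zero ℝ p m] with x hx
    rw [hx]; simp
  · rintro S T hST ⟨𝒦, h𝒦, S', h1, h2⟩
    exact ⟨𝒦, h𝒦, S', hST.trans h1, h2⟩
  · rintro S T ⟨𝒦₁, h𝒦₁, S', hS', hSm, h₁⟩ ⟨𝒦₂, h𝒦₂, T', hT', hTm, h₂⟩
    refine ⟨𝒦₁ + 𝒦₂, h𝒦₁.add h𝒦₂, S' ∪ T', union_subset_union hS' hT', hSm.union hTm,
      fun ν hν hν0 hνR => ?_⟩
    obtain ⟨w₁, hw₁, hn₁⟩ := h₁ ν hν hν0 hνR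
    -- Removing S' from ν counts the overlap only once, so the two errors add up to ε ν(S' ∪ T').
    obtain ⟨w₂, hw₂, hn₂⟩ := h₂ (ν.restrict S'ᶜ) inferInstance
      (le_antisymm ((Measure.restrict_apply_le _ _).trans_eq hν0) zero_le)
      ((Measure.restrict_apply_le _ _).trans hνR)
    refine ⟨w₁ + w₂, Set.add_mem_add hw₁ hw₂, ?_⟩
    have hrr : (ν.restrict S'ᶜ).restrict T' = ν.restrict (T' \ S') := by
      rw [Measure.restrict_restrict hTm, sdiff_eq]
    have hint := ae_integrable_of_eLpNorm_le (m := m) (ν := ν) hp1 hp hK hB ((hae ν hν0).mono hKB)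
    calc eLpNorm (fun x => ∫ y in S' ∪ T', K x y ∂ν - (w₁ + w₂ : Lp ℝ p m) x) p m
        = eLpNorm ((fun x => ∫ y in S', K x y ∂ν - w₁ x) +
            fun x => ∫ y in T', K x y ∂(ν.restrict S'ᶜ) - w₂ x) p m := by
          apply eLpNorm_congr_ae
          filter_upwards [hint, Lp.coeFn_add w₁ w₂] with x hx hw
          rw [hw, hrr, Pi.add_apply, Pi.add_apply, ← union_sdiff_self,
            setIntegral_union disjoint_sdiff_right (hTm.diff hSm) hx.integrableOn hx.integrableOn]
          ring
      _ ≤ _ := eLpNorm_add_le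
          ((aestronglyMeasurable_integral_kernel hK _).sub (Lp.aestronglyMeasurable w₁))
          ((aestronglyMeasurable_integral_kernel hK _).sub (Lp.aestronglyMeasurable w₂)) hp1
      _ ≤ ε * ν S' + ε * (ν.restrict S'ᶜ) T' := add_le_add hn₁ hn₂
      _ = ε * ν (S' ∪ T') := by
          rw [← mul_add, Measure.restrict_apply hTm, ← sdiff_eq, ← union_sdiff_self,
            measure_union disjoint_sdiff_right (hTm.diff hSm)]
  · intro z hz
    -- On a neighbourhood U where K(·,y) is ε-close to k, the integral over U is close to ν(U) k,
    -- which lies on the compact segment [0, R] k.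
    obtain ⟨k, hkm, hk, hkt⟩ := hlim z hz
    have hev := hkt.eventually (ge_mem_nhds hε)
    rw [eventually_nhdsWithin_iff, eventually_nhds_iff] at hev
    obtain ⟨U, hU, hUo, hzU⟩ := hev
    refine ⟨U, mem_nhdsWithin_of_mem_nhds (hUo.mem_nhds hzU),
      (fun c : ℝ => c • hk.toLp) '' Icc 0 R, isCompact_Icc.image (by fun_prop),
      U, subset_rfl, hUo.measurableSet, fun ν hν hν0 hνR => ?_⟩
    refine ⟨_, ⟨ν.real U, ⟨measureReal_nonneg, ?_⟩, rfl⟩, ?_⟩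
    · exact ENNReal.toReal_le_of_le_ofReal hR ((measure_mono (subset_univ _)).trans hνR)
    · have hint := ae_integrable_of_eLpNorm_le (m := m) (ν := ν) hp1 hp hK hB
        ((hae ν hν0).mono hKB)
      calc _ = eLpNorm (fun x => ∫ y in U, (K x y - k x) ∂ν) p m := by
            apply eLpNorm_congr_ae
            filter_upwards [hint, Lp.coeFn_smul (ν.real U) hk.toLp, hk.coeFn_toLp] with x hx h1 h2
            rw [h1, Pi.smul_apply, h2, integral_sub hx.integrableOn (integrable_const _),
              setIntegral_const]
        _ ≤ ε * (ν.restrict U) univ := by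
            refine eLpNorm_integral_le hp1 hp (hK.sub (hkm.comp measurable_fst)) ?_
            filter_upwards [ae_restrict_mem hUo.measurableSet, ae_restrict_of_ae (hae ν hν0)] with
              y hy1 hy2 using hU y hy1 hy2
        _ = _ := by rw [Measure.restrict_apply_univ]

/-- The integrals lie within arbitrarily small distance of compact sets, hence form a totally
bounded set, and L^p is complete. -/
theorem exists_subseq_tendsto_integral_kernel [Fact (1 ≤ p)] (hp : p ≠ ⊤)
    (hK : Measurable (Function.uncurry K))
    {B : ℝ≥0∞} (hB : B < ⊤) (hKB : ∀ y ∈ Ω, eLpNorm (fun x => K x y) p m ≤ B) (hS : IsCompact S)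
    (hΩS : Ω ⊆ S) (hlim : ∀ z ∈ S, ∃ k : X → ℝ, Measurable k ∧ MemLp k p m ∧
      Tendsto (fun y => eLpNorm (fun x => K x y - k x) p m) (𝓝[Ω] z) (𝓝 0))
    {R : ℝ≥0∞} (hR : R < ⊤) (ν : ℕ → Measure Y) (hν : ∀ n, ν n Ωᶜ = 0) (hνR : ∀ n, ν n univ ≤ R) :
    ∃ k : ℕ → ℕ, StrictMono k ∧ ∃ u : X → ℝ, MemLp u p m ∧
      Tendsto (fun n => eLpNorm (fun x => ∫ y, K x y ∂(ν (k n)) - u x) p m) atTop (𝓝 0) := by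
  have hp1 : 1 ≤ p := Fact.out
  have hfin : ∀ n, IsFiniteMeasure (ν n) := fun n => ⟨(hνR n).trans_lt hR⟩
  have hae : ∀ n, ∀ᵐ y ∂(ν n), y ∈ Ω := fun n => by rw [ae_iff]; exact hν n
  have hmem : ∀ n, MemLp (fun x => ∫ y, K x y ∂(ν n)) p m := fun n =>
    memLp_integral_kernel hp1 hp hK hB ((hae n).mono hKB)
  let F : ℕ → Lp ℝ p m := fun n => (hmem n).toLp
  have htb : TotallyBounded (range F) := by
    rw [Metric.totallyBounded_iff]
    intro ε hε
    obtain ⟨𝒦, h𝒦, S', hSS, hS'm, happ⟩ := exists_isCompact_approx hp hK hB hKB hS hlim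
      (R := R.toReal) ENNReal.toReal_nonneg (ε := ENNReal.ofReal (ε / 3 / (R.toReal + 1))) (by simp; positivity)
    obtain ⟨t, ht, htc⟩ := Metric.totallyBounded_iff.mp h𝒦.totallyBounded (ε / 2) (by positivity)
    refine ⟨t, ht, ?_⟩
    rintro _ ⟨n, rfl⟩
    obtain ⟨w, hw, hwn⟩ := happ (ν n) (hfin n) (hν n) (by rw [ENNReal.ofReal_toReal hR.ne]; exact hνR n)
    rw [Measure.restrict_eq_self_of_ae_mem ((hae n).mono fun y hy => hSS (hΩS hy))] at hwn
    obtain ⟨v, hv, hwv⟩ := mem_iUnion₂.mp (htc hw)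
    refine mem_iUnion₂.mpr ⟨v, hv, ?_⟩
    have hd : edist (F n) w ≤ ENNReal.ofReal (ε / 3) := by
      rw [Lp.edist_def]
      have : eLpNorm (⇑(F n) - ⇑w) p m = eLpNorm (fun x => ∫ y, K x y ∂(ν n) - w x) p m := by
        apply eLpNorm_congr_ae
        filter_upwards [(hmem n).coeFn_toLp] with x hx
        simp only [Pi.sub_apply, F, hx]
      rw [this]
      refine hwn.trans ?_
      calc _ ≤ ENNReal.ofReal (ε / 3 / (R.toReal + 1)) * ENNReal.ofReal (R.toReal + 1) := by
            gcongr
            refine (measure_mono (subset_univ _)).trans ((hνR n).trans ?_)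
            conv_lhs => rw [← ENNReal.ofReal_toReal (a := R) hR.ne]
            exact ENNReal.ofReal_le_ofReal (by linarith)
        _ = _ := by
            rw [← ENNReal.ofReal_mul (by positivity)]
            congr 1; field_simp
    rw [edist_dist, ENNReal.ofReal_le_ofReal_iff (by positivity)] at hd
    rw [Metric.mem_ball] at hwv ⊢
    linarith [dist_triangle (F n) w v]
  have hc : IsCompact (closure (range F)) :=
    htb.closure.isCompact_of_isClosed isClosed_closure
  obtain ⟨u, _, k, hk, hku⟩ := hc.tendsto_subseq fun n => subset_closure (mem_range_self n)
  refine ⟨k, hk, u, Lp.memLp u, ?_⟩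
  rw [Lp.tendsto_Lp_iff_tendsto_eLpNorm'] at hku
  refine hku.congr fun n => eLpNorm_congr_ae ?_
  filter_upwards [(hmem (k n)).coeFn_toLp] with x hx
  simp only [Pi.sub_apply, Function.comp, F, hx]

end IntegralOperators

end GreenCompactness

/-! ### Limits of a singular kernel in the weighted Lebesgue space -/

namespace GreenCompactness

variable {N : ℕ} {Ω : Set (Eu N)}

theorem measurable_ofReal_bdist_rpow (Ω : Set (Eu N)) (β : ℝ) :
    Measurable fun x => ENNReal.ofReal (bdist Ω x ^ β) :=
  ((continuous_bdist Ω).measurable.pow_const β).ennreal_ofReal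

theorem eLpNorm_weightedVolume {q : ℝ} (hq : 0 < q) (α : ℝ) (f : Eu N → ℝ) :
    eLpNorm f (ENNReal.ofReal q) (weightedVolume Ω α) =
      (∫⁻ x in Ω, ENNReal.ofReal (|f x| ^ q * bdist Ω x ^ α)) ^ (1 / q) := by
  rw [eLpNorm_eq_lintegral_rpow_enorm_toReal (by simpa using hq) (by simp), weightedVolume,
    lintegral_withDensity_eq_lintegral_mul_non_measurable _ (measurable_ofReal_bdist_rpow Ω α)
      (by simp), ENNReal.toReal_ofReal hq.le]
  congr 2
  ext x
  rw [Pi.mul_apply, ENNReal.ofReal_mul (by positivity), mul_comm,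
    ← ENNReal.ofReal_rpow_of_nonneg (abs_nonneg _) hq.le, Real.enorm_eq_ofReal_abs]

theorem abs_sub_rpow_le {q : ℝ} (hq : 0 ≤ q) (u v : ℝ) :
    |u - v| ^ q ≤ 2 ^ q * (|u| ^ q + |v| ^ q) := by
  calc |u - v| ^ q ≤ (2 * max |u| |v|) ^ q := by
        gcongr
        have := abs_sub u v
        linarith [le_max_left |u| |v|, le_max_right |u| |v|]
    _ = 2 ^ q * max |u| |v| ^ q := Real.mul_rpow (by norm_num) (by positivity)
    _ ≤ _ := by
        gcongr
        rcases max_cases |u| |v| with h | h <;> rw [h.1]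
        · exact le_add_of_nonneg_right (by positivity)
        · exact le_add_of_nonneg_left (by positivity)

theorem subset_closedBall_of_mem_closure {D : ℝ} (hD : ∀ x ∈ Ω, ∀ y ∈ Ω, ‖x - y‖ ≤ D)
    {z : Eu N} (hz : z ∈ closure Ω) : Ω ⊆ Metric.closedBall z D := by
  intro x hx
  have : closure Ω ⊆ Metric.closedBall x D :=
    closure_minimal (fun y hy => by rw [Metric.mem_closedBall, dist_eq_norm]; exact hD y hy x hx)
      Metric.isClosed_closedBall
  exact Metric.mem_closedBall_comm.mp (this hz)

section KernelLimits

variable {q α a b C : ℝ} {K : Eu N → Eu N → ℝ}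

theorem exists_lintegral_singular_le (hN : 0 < N) (hΩ : IsC2BoundedDomain Ω)
    (ha : 0 ≤ a) (ha1 : a < 1) (hb : 0 ≤ b) (hab : a + b < N) :
    ∃ B : ℝ, 0 ≤ B ∧ ∀ z ∈ closure Ω,
      ∫⁻ x in Ω, ENNReal.ofReal (bdist Ω x ^ (-a) * ‖x - z‖ ^ (-b)) ≤ ENNReal.ofReal B := by
  obtain ⟨D, hD, -, hdiam⟩ := exists_bdist_le hΩ.isBounded
  obtain ⟨V, hV, h⟩ := lintegral_bdist_rpow_mul_norm_rpow_le hN hΩ D ha ha1 hb hab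
  refine ⟨V * D ^ ((N : ℝ) - a - b), by positivity, fun z hz => ?_⟩
  have := h z D hD le_rfl
  rwa [inter_eq_self_of_subset_left (subset_closedBall_of_mem_closure hdiam hz)] at this

theorem lintegral_bdist_rpow_lt_top (hN : 0 < N) (hΩ : IsC2BoundedDomain Ω)
    (ha : 0 ≤ a) (ha1 : a < 1) :
    ∫⁻ x in Ω, ENNReal.ofReal (bdist Ω x ^ (-a)) < ⊤ := by
  have h1 : (1 : ℝ) ≤ N := by exact_mod_cast hN
  obtain ⟨B, -, h⟩ := exists_lintegral_singular_le (b := 0) hN hΩ ha ha1 le_rfl (by linarith)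
  obtain ⟨z, hz⟩ := hΩ.isConnected.nonempty
  have := h z (subset_closure hz)
  simp only [neg_zero, Real.rpow_zero, mul_one] at this
  exact this.trans_lt ENNReal.ofReal_lt_top

theorem eLpNorm_le_of_singular_bound (hq : 0 < q) (hC : 0 ≤ C) {B : ℝ} {z : Eu N}
    (hB : ∫⁻ x in Ω, ENNReal.ofReal (bdist Ω x ^ (-a) * ‖x - z‖ ^ (-b)) ≤ ENNReal.ofReal B)
    {f : Eu N → ℝ} (hf : ∀ᵐ x ∂(volume.restrict Ω),
      |f x| ^ q * bdist Ω x ^ α ≤ C * (bdist Ω x ^ (-a) * ‖x - z‖ ^ (-b))) :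
    eLpNorm f (ENNReal.ofReal q) (weightedVolume Ω α) ≤ ENNReal.ofReal (C * B) ^ (1 / q) := by
  rw [eLpNorm_weightedVolume hq]
  gcongr
  calc _ ≤ ∫⁻ x in Ω, ENNReal.ofReal (C * (bdist Ω x ^ (-a) * ‖x - z‖ ^ (-b))) :=
        lintegral_mono_ae (hf.mono fun x hx => ENNReal.ofReal_le_ofReal hx)
    _ = ENNReal.ofReal C * ∫⁻ x in Ω, ENNReal.ofReal (bdist Ω x ^ (-a) * ‖x - z‖ ^ (-b)) := by
        simp_rw [ENNReal.ofReal_mul hC]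
        rw [lintegral_const_mul' _ _ ENNReal.ofReal_ne_top]
    _ ≤ _ := by rw [ENNReal.ofReal_mul hC]; gcongr

theorem ae_restrict_ne (hN : 0 < N) (z : Eu N) : ∀ᵐ x ∂(volume.restrict Ω), x ≠ z := by
  have : Nonempty (Fin N) := ⟨⟨0, hN⟩⟩
  exact ae_restrict_of_ae (by simp [ae_iff])

/-- Vitali-type argument. The singularity of K(·,y) moves with y, so no single dominating function
is available near z; there the uniform bound on integrals over small balls is used. Away from z,
dominated convergence applies. -/
theorem tendsto_eLpNorm_sub_of_ae_tendsto (hN : 0 < N) (hΩ : IsC2BoundedDomain Ω) (hq : 1 ≤ q)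
    (ha : 0 ≤ a) (ha1 : a < 1) (hb : 0 ≤ b) (hab : a + b < N) (hC : 0 ≤ C)
    (hK : Measurable (Function.uncurry K))
    (hbound : ∀ x ∈ Ω, ∀ y ∈ Ω, x ≠ y →
      |K x y| ^ q * bdist Ω x ^ α ≤ C * (bdist Ω x ^ (-a) * ‖x - y‖ ^ (-b)))
    {z : Eu N} {k : Eu N → ℝ} (hk : Measurable k)
    (hkb : ∀ᵐ x ∂(volume.restrict Ω),
      |k x| ^ q * bdist Ω x ^ α ≤ C * (bdist Ω x ^ (-a) * ‖x - z‖ ^ (-b)))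
    (hlim : ∀ᵐ x ∂(volume.restrict Ω), Tendsto (fun y => K x y) (𝓝[Ω] z) (𝓝 (k x))) :
    Tendsto (fun y => eLpNorm (fun x => K x y - k x) (ENNReal.ofReal q) (weightedVolume Ω α))
      (𝓝[Ω] z) (𝓝 0) := by
  have hq0 : 0 < q := by linarith
  have hm := hΩ.isOpen.measurableSet
  set e : ℝ := (N : ℝ) - a - b with he
  have he0 : 0 < e := by rw [he]; linarith
  simp_rw [eLpNorm_weightedVolume hq0]
  suffices h : Tendsto (fun y => ∫⁻ x in Ω, ENNReal.ofReal (|K x y - k x| ^ q * bdist Ω x ^ α))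
      (𝓝[Ω] z) (𝓝 0) by
    have := h.ennrpow_const (1 / q)
    rwa [ENNReal.zero_rpow_of_pos (by positivity)] at this
  have hdiff : ∀ y ∈ Ω, ∀ᵐ x ∂(volume.restrict Ω), |K x y - k x| ^ q * bdist Ω x ^ α ≤
      2 ^ q * C * (bdist Ω x ^ (-a) * ‖x - y‖ ^ (-b)) +
      2 ^ q * C * (bdist Ω x ^ (-a) * ‖x - z‖ ^ (-b)) := by
    intro y hy
    filter_upwards [hkb, ae_restrict_mem hm, ae_restrict_ne hN y] with x h1 hx hxy
    have h2 := hbound x hx y hy hxy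
    have h0 : 0 ≤ bdist Ω x ^ α := Real.rpow_nonneg Metric.infDist_nonneg _
    calc _ ≤ 2 ^ q * (|K x y| ^ q + |k x| ^ q) * bdist Ω x ^ α := by
          gcongr; exact abs_sub_rpow_le hq0.le _ _
      _ = 2 ^ q * (|K x y| ^ q * bdist Ω x ^ α + |k x| ^ q * bdist Ω x ^ α) := by ring
      _ ≤ 2 ^ q * (C * (bdist Ω x ^ (-a) * ‖x - y‖ ^ (-b)) +
          C * (bdist Ω x ^ (-a) * ‖x - z‖ ^ (-b))) := by gcongr
      _ = _ := by ring
  obtain ⟨V, hV, hball⟩ := lintegral_bdist_rpow_mul_norm_rpow_le hN hΩ 1 ha ha1 hb hab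
  have hW : (0 : ℝ) ≤ 2 ^ q * C := by positivity
  rw [ENNReal.tendsto_nhds_zero]
  intro ε hε
  -- a radius for which the integral over the ball around `z` is small
  have hsmall : Tendsto (fun ρ : ℝ => ENNReal.ofReal (2 * (2 ^ q * C) * (V * (2 * ρ) ^ e)))
      (𝓝[>] 0) (𝓝 0) := by
    have hcont : Continuous fun ρ : ℝ => ENNReal.ofReal (2 * (2 ^ q * C) * (V * (2 * ρ) ^ e)) :=
      ENNReal.continuous_ofReal.comp (continuous_const.mul (continuous_const.mul
        ((continuous_const.mul continuous_id).rpow_const fun _ => Or.inr he0.le)))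
    have := hcont.tendsto 0
    simp only [mul_zero, Real.zero_rpow he0.ne', ENNReal.ofReal_zero] at this
    exact this.mono_left nhdsWithin_le_nhds
  obtain ⟨ρ, hρε, hρ0, hρ1⟩ := ((hsmall.eventually (ge_mem_nhds
    (ENNReal.half_pos hε.ne'))).and (Ioo_mem_nhdsGT (show (0 : ℝ) < 1 / 2 by norm_num))).exists
  have hnear : ∀ y ∈ Ω ∩ Metric.ball z ρ,
      ∫⁻ x in Ω ∩ Metric.closedBall z ρ, ENNReal.ofReal (|K x y - k x| ^ q * bdist Ω x ^ α) ≤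
        ε / 2 := by
    rintro y ⟨hy, hyz⟩
    refine le_trans ?_ hρε
    have hsub : Ω ∩ Metric.closedBall z ρ ⊆ Ω ∩ Metric.closedBall y (2 * ρ) := by
      gcongr
      apply Metric.closedBall_subset_closedBall'
      have := Metric.mem_ball'.mp hyz
      linarith
    have i1 := (lintegral_mono_set hsub).trans (hball y (2 * ρ) (by positivity) (by linarith))
    have i2 := (hball z ρ hρ0 (by linarith)).trans (ENNReal.ofReal_le_ofReal
      (show V * ρ ^ e ≤ V * (2 * ρ) ^ e by gcongr; linarith))
    calc ∫⁻ x in Ω ∩ Metric.closedBall z ρ, ENNReal.ofReal (|K x y - k x| ^ q * bdist Ω x ^ α)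
        ≤ ∫⁻ x in Ω ∩ Metric.closedBall z ρ, (ENNReal.ofReal (2 ^ q * C) *
              ENNReal.ofReal (bdist Ω x ^ (-a) * ‖x - y‖ ^ (-b)) + ENNReal.ofReal (2 ^ q * C) *
              ENNReal.ofReal (bdist Ω x ^ (-a) * ‖x - z‖ ^ (-b))) := by
          apply lintegral_mono_ae
          have := ae_restrict_of_ae_restrict_of_subset inter_subset_left (hdiff y hy)
            (t := Ω) (s := Ω ∩ Metric.closedBall z ρ)
          filter_upwards [this] with x hx
          rw [← ENNReal.ofReal_mul hW, ← ENNReal.ofReal_mul hW]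
          exact (ENNReal.ofReal_le_ofReal hx).trans ENNReal.ofReal_add_le
      _ ≤ ENNReal.ofReal (2 ^ q * C) * ENNReal.ofReal (V * (2 * ρ) ^ e) +
          ENNReal.ofReal (2 ^ q * C) * ENNReal.ofReal (V * (2 * ρ) ^ e) := by
          have hmeas : Measurable fun x => ENNReal.ofReal (2 ^ q * C) *
              ENNReal.ofReal (bdist Ω x ^ (-a) * ‖x - y‖ ^ (-b)) := by
            have := (continuous_bdist Ω).measurable
            fun_prop
          rw [lintegral_add_left hmeas, lintegral_const_mul' _ _ ENNReal.ofReal_ne_top,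
            lintegral_const_mul' _ _ ENNReal.ofReal_ne_top]
          gcongr
      _ = _ := by
          rw [← two_mul, ← ENNReal.ofReal_mul hW, mul_assoc (2 : ℝ),
            ENNReal.ofReal_mul (zero_le_two (α := ℝ)), ENNReal.ofReal_ofNat]
  have hfar : Tendsto (fun y => ∫⁻ x in Ω \ Metric.closedBall z ρ,
      ENNReal.ofReal (|K x y - k x| ^ q * bdist Ω x ^ α)) (𝓝[Ω] z) (𝓝 0) := by
    have hall : ∀ {P : Eu N → Prop}, (∀ᵐ x ∂(volume.restrict Ω), P x) →
        ∀ᵐ x ∂(volume.restrict (Ω \ Metric.closedBall z ρ)), P x :=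
      fun h => ae_restrict_of_ae_restrict_of_subset sdiff_subset h
    have := tendsto_lintegral_filter_of_dominated_convergence
      (μ := volume.restrict (Ω \ Metric.closedBall z ρ)) (l := 𝓝[Ω] z)
      (F := fun y x => ENNReal.ofReal (|K x y - k x| ^ q * bdist Ω x ^ α)) (f := fun _ => 0)
      (fun x => ENNReal.ofReal (2 * (2 ^ q * C) * (ρ / 2) ^ (-b)) *
        ENNReal.ofReal (bdist Ω x ^ (-a))) ?_ ?_ ?_ ?_
    · simpa using this
    · refine Eventually.of_forall fun y => ?_
      have h1 : Measurable fun x => K x y := hK.of_uncurry_right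
      have := (continuous_bdist Ω).measurable
      fun_prop
    -- For |y - z| < ρ/2 and |x - z| > ρ the singularity at y stays at distance at least ρ/2 from x,
    -- which leaves a multiple of δ(x)^(-a) as majorant.
    · filter_upwards [self_mem_nhdsWithin,
        mem_nhdsWithin_of_mem_nhds (Metric.ball_mem_nhds z (half_pos hρ0))] with y hy hyz
      filter_upwards [hall (hdiff y hy),
        ae_restrict_mem (hm.diff measurableSet_closedBall)] with x hx hxm
      have hxz : ρ < ‖x - z‖ := by
        have := hxm.2
        rw [Metric.mem_closedBall, dist_eq_norm] at this
        linarith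
      have hyz' : ‖y - z‖ < ρ / 2 := by rwa [Metric.mem_ball, dist_eq_norm] at hyz
      have hxy : ρ / 2 ≤ ‖x - y‖ := by
        have := norm_sub_le_norm_sub_add_norm_sub x y z
        linarith
      have h0 : 0 ≤ bdist Ω x ^ (-a) := Real.rpow_nonneg Metric.infDist_nonneg _
      have h1 : ‖x - y‖ ^ (-b) ≤ (ρ / 2) ^ (-b) :=
        Real.rpow_le_rpow_of_nonpos (by positivity) hxy (by linarith)
      have h2 : ‖x - z‖ ^ (-b) ≤ (ρ / 2) ^ (-b) :=
        Real.rpow_le_rpow_of_nonpos (by positivity) (by linarith) (by linarith)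
      rw [← ENNReal.ofReal_mul (by positivity)]
      apply ENNReal.ofReal_le_ofReal
      calc _ ≤ _ := hx
        _ ≤ 2 ^ q * C * (bdist Ω x ^ (-a) * (ρ / 2) ^ (-b)) +
            2 ^ q * C * (bdist Ω x ^ (-a) * (ρ / 2) ^ (-b)) := by gcongr
        _ = _ := by ring
    · rw [lintegral_const_mul' _ _ ENNReal.ofReal_ne_top]
      refine ENNReal.mul_ne_top ENNReal.ofReal_ne_top (ne_of_lt ?_)
      exact (lintegral_mono_set sdiff_subset).trans_lt (lintegral_bdist_rpow_lt_top hN hΩ ha ha1)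
    · filter_upwards [hall hlim] with x hx
      have h1 : Tendsto (fun y => |K x y - k x| ^ q * bdist Ω x ^ α) (𝓝[Ω] z)
          (𝓝 (|k x - k x| ^ q * bdist Ω x ^ α)) :=
        ((hx.sub_const _).abs.rpow_const (Or.inr hq0.le)).mul_const _
      have := ENNReal.tendsto_ofReal h1
      simpa [Real.zero_rpow hq0.ne'] using this
  filter_upwards [self_mem_nhdsWithin, mem_nhdsWithin_of_mem_nhds (Metric.ball_mem_nhds z hρ0),
    hfar.eventually (ge_mem_nhds (ENNReal.half_pos hε.ne'))] with y hy hyz hyf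
  rw [← lintegral_inter_add_sdiff _ Ω (measurableSet_closedBall (x := z) (ε := ρ)),
    ← ENNReal.add_halves ε]
  exact add_le_add (hnear y ⟨hy, hyz⟩) hyf

/-- The singular bound passes to the pointwise limit with y replaced by z. This puts the limit in
L^q and supplies the bound needed for convergence in norm. -/
theorem exists_limit_of_tendsto (hN : 0 < N) (hΩ : IsC2BoundedDomain Ω) (hq : 1 ≤ q)
    (ha : 0 ≤ a) (ha1 : a < 1) (hb : 0 ≤ b) (hab : a + b < N) (hC : 0 ≤ C)
    (hK : Measurable (Function.uncurry K))
    (hbound : ∀ x ∈ Ω, ∀ y ∈ Ω, x ≠ y →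
      |K x y| ^ q * bdist Ω x ^ α ≤ C * (bdist Ω x ^ (-a) * ‖x - y‖ ^ (-b)))
    {z : Eu N} (hz : z ∈ closure Ω) {κ : Eu N → ℝ}
    (hlim : ∀ x ∈ Ω, x ≠ z → Tendsto (fun y => K x y) (𝓝[Ω] z) (𝓝 (κ x))) :
    ∃ k : Eu N → ℝ, Measurable k ∧ MemLp k (ENNReal.ofReal q) (weightedVolume Ω α) ∧
      Tendsto (fun y => eLpNorm (fun x => K x y - k x) (ENNReal.ofReal q) (weightedVolume Ω α))
        (𝓝[Ω] z) (𝓝 0) := by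
  have hm := hΩ.isOpen.measurableSet
  have : (𝓝[Ω] z).NeBot := mem_closure_iff_nhdsWithin_neBot.mp hz
  have hlim' : ∀ᵐ x ∂(volume.restrict Ω), Tendsto (fun y => K x y) (𝓝[Ω] z) (𝓝 (κ x)) := by
    filter_upwards [ae_restrict_mem hm, ae_restrict_ne hN z] with x hx hxz using hlim x hx hxz
  have hκ : AEMeasurable κ (volume.restrict Ω) :=
    aemeasurable_of_tendsto_metrizable_ae (𝓝[Ω] z) (f := fun y x => K x y)
      (fun y => (hK.of_uncurry_right).aemeasurable) hlim'
  set k := hκ.mk κ with hk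
  have hkm : Measurable k := hκ.measurable_mk
  have hklim : ∀ᵐ x ∂(volume.restrict Ω), Tendsto (fun y => K x y) (𝓝[Ω] z) (𝓝 (k x)) := by
    filter_upwards [hlim', hκ.ae_eq_mk] with x h1 h2
    rwa [h2] at h1
  have hkb : ∀ᵐ x ∂(volume.restrict Ω),
      |k x| ^ q * bdist Ω x ^ α ≤ C * (bdist Ω x ^ (-a) * ‖x - z‖ ^ (-b)) := by
    filter_upwards [hklim, ae_restrict_mem hm, ae_restrict_ne hN z] with x h1 hx hxz
    have h2 : Tendsto (fun y => |K x y| ^ q * bdist Ω x ^ α) (𝓝[Ω] z)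
        (𝓝 (|k x| ^ q * bdist Ω x ^ α)) :=
      (h1.abs.rpow_const (Or.inr (by linarith))).mul_const _
    have h3 : Tendsto (fun y => C * (bdist Ω x ^ (-a) * ‖x - y‖ ^ (-b))) (𝓝[Ω] z)
        (𝓝 (C * (bdist Ω x ^ (-a) * ‖x - z‖ ^ (-b)))) := by
      refine Tendsto.const_mul _ (Tendsto.const_mul _ ?_)
      have h4 : Tendsto (fun y => ‖x - y‖) (𝓝[Ω] z) (𝓝 ‖x - z‖) :=
        ((continuous_const.sub continuous_id).norm.tendsto z).mono_left nhdsWithin_le_nhds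
      exact h4.rpow_const (Or.inl (norm_ne_zero_iff.mpr (sub_ne_zero.mpr hxz)))
    refine le_of_tendsto_of_tendsto h2 h3 ?_
    filter_upwards [self_mem_nhdsWithin,
      mem_nhdsWithin_of_mem_nhds (isOpen_ne.mem_nhds hxz.symm)] with y hy hyx
    exact hbound x hx y hy (Ne.symm hyx)
  obtain ⟨B, hB0, hB⟩ := exists_lintegral_singular_le hN hΩ ha ha1 hb hab
  refine ⟨k, hkm, ⟨hkm.aestronglyMeasurable, ?_⟩, tendsto_eLpNorm_sub_of_ae_tendsto hN hΩ hq ha ha1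
    hb hab hC hK hbound hkm hkb hklim⟩
  refine (eLpNorm_le_of_singular_bound (by linarith) hC (hB z hz) hkb).trans_lt ?_
  exact ENNReal.rpow_lt_top_of_nonneg (by positivity) ENNReal.ofReal_ne_top

end KernelLimits

end GreenCompactness

/-! ### The Green operator -/

namespace GreenCompactness

variable {N : ℕ} {Ω : Set (Eu N)}

/-- The Green kernel normalised by `δ(y) ^ (-β)`, set to zero off `(Ω × Ω) ∖ D_Ω`. -/
noncomputable def normalizedKernel (Ω : Set (Eu N)) (G : Eu N → Eu N → ℝ) (β : ℝ) (x y : Eu N) :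
    ℝ :=
  (offDiagonal Ω).indicator (Function.uncurry G) (x, y) * bdist Ω y ^ (-β)

theorem normalizedKernel_of_mem {G : Eu N → Eu N → ℝ} {β : ℝ} {x y : Eu N} (hx : x ∈ Ω)
    (hy : y ∈ Ω) (hxy : x ≠ y) : normalizedKernel Ω G β x y = G x y * bdist Ω y ^ (-β) := by
  have : (x, y) ∈ offDiagonal Ω := ⟨hx, hy, hxy⟩
  rw [normalizedKernel, indicator_of_mem this]
  rfl

theorem measurableSet_offDiagonal (hΩ : IsOpen Ω) : MeasurableSet (offDiagonal Ω) := by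
  have : offDiagonal Ω = (Ω ×ˢ Ω) ∩ {p : Eu N × Eu N | p.1 = p.2}ᶜ := by
    ext p; simp [offDiagonal, and_assoc]
  rw [this]
  exact (hΩ.measurableSet.prod hΩ.measurableSet).inter
    (isClosed_eq continuous_fst continuous_snd).measurableSet.compl

theorem measurable_normalizedKernel (hΩ : IsOpen Ω) {G : Eu N → Eu N → ℝ}
    (hG : Measurable ((offDiagonal Ω).domRestrict (Function.uncurry G))) (β : ℝ) :
    Measurable (Function.uncurry (normalizedKernel Ω G β)) := by
  have hm := measurableSet_offDiagonal hΩ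
  have h1 : Measurable ((offDiagonal Ω).indicator (Function.uncurry G)) := by
    refine measurable_of_restrict_of_restrict_compl hm ?_ ?_
    · convert hG using 1
      ext p; exact indicator_of_mem p.2 _
    · convert measurable_const (a := (0 : ℝ)) using 1
      ext p; exact indicator_of_notMem p.2 _
  exact h1.mul (((continuous_bdist Ω).measurable.comp measurable_snd).pow_const _)

/-- An s-finite measure has countably many atoms. This makes the arbitrary value of G on the
diagonal harmless: `G x x` affects ∫ G(x,y) dμ(y) only when x is an atom of μ. -/
theorem ae_measure_singleton_eq_zero (hN : 0 < N) (ν : Measure (Eu N)) [SFinite ν] :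
    ∀ᵐ x ∂(volume : Measure (Eu N)), ν {x} = 0 := by
  have : Nonempty (Fin N) := ⟨⟨0, hN⟩⟩
  have h := Measure.countable_meas_pos_of_disjoint_iUnion (μ := ν)
    (As := fun x : Eu N => ({x} : Set (Eu N))) (fun x => measurableSet_singleton x)
    (fun x y hxy => by simpa [Function.onFun] using hxy)
  rw [ae_iff]
  convert h.measure_zero volume using 2
  ext x
  simp [pos_iff_ne_zero]

/-- The measure `δ^β μ`. -/
noncomputable def weightedMeasure (Ω : Set (Eu N)) (β : ℝ) (μ : Measure (Eu N)) :
    Measure (Eu N) :=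
  μ.withDensity fun y => ENNReal.ofReal (bdist Ω y ^ β)

theorem weightedMeasure_compl {μ : Measure (Eu N)} (hμ : μ Ωᶜ = 0) (β : ℝ) :
    weightedMeasure Ω β μ Ωᶜ = 0 :=
  withDensity_absolutelyContinuous _ _ hμ

theorem weightedMeasure_univ {μ : Measure (Eu N)} (hμ : μ Ωᶜ = 0) (β : ℝ) :
    weightedMeasure Ω β μ univ = ∫⁻ y in Ω, ENNReal.ofReal (bdist Ω y ^ β) ∂μ := by
  rw [weightedMeasure, withDensity_apply _ MeasurableSet.univ, Measure.restrict_univ,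
    Measure.restrict_eq_self_of_ae_mem (by rwa [ae_iff])]

section

variable {G : Eu N → Eu N → ℝ} {β : ℝ} {μ : Measure (Eu N)} {x : Eu N}

theorem ae_bdist_rpow_smul_normalizedKernel (hN : 0 < N) (ho : IsOpen Ω)
    (hb : Bornology.IsBounded Ω) (hμ : μ Ωᶜ = 0) (hx : x ∈ Ω)
    (hνx : weightedMeasure Ω β μ {x} = 0) :
    ∀ᵐ y ∂μ, (ENNReal.ofReal (bdist Ω y ^ β)).toReal • normalizedKernel Ω G β x y = G x y := by
  have hΩ : ∀ᵐ y ∂μ, y ∈ Ω := by rwa [ae_iff]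
  have hne : ∀ᵐ y ∂(weightedMeasure Ω β μ), y ≠ x := by simpa [ae_iff] using hνx
  rw [weightedMeasure, ae_withDensity_iff (measurable_ofReal_bdist_rpow Ω β)] at hne
  filter_upwards [hΩ, hne] with y hy hyx
  have hd := bdist_pos hN ho hb hy
  have hpos : 0 < bdist Ω y ^ β := Real.rpow_pos_of_pos hd _
  rw [normalizedKernel_of_mem hx hy (Ne.symm (hyx (by simpa using hpos))),
    ENNReal.toReal_ofReal hpos.le, smul_eq_mul, Real.rpow_neg hd.le]
  field_simp

theorem integral_normalizedKernel (hN : 0 < N) (ho : IsOpen Ω)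
    (hb : Bornology.IsBounded Ω) (hμ : μ Ωᶜ = 0) (hx : x ∈ Ω)
    (hνx : weightedMeasure Ω β μ {x} = 0) :
    ∫ y, normalizedKernel Ω G β x y ∂(weightedMeasure Ω β μ) = ∫ y, G x y ∂μ := by
  rw [weightedMeasure, integral_withDensity_eq_integral_toReal_smul
    (measurable_ofReal_bdist_rpow Ω β) (by simp)]
  exact integral_congr_ae (ae_bdist_rpow_smul_normalizedKernel hN ho hb hμ hx hνx)

theorem integrable_of_normalizedKernel (hN : 0 < N) (ho : IsOpen Ω)
    (hb : Bornology.IsBounded Ω) (hμ : μ Ωᶜ = 0) (hx : x ∈ Ω)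
    (hνx : weightedMeasure Ω β μ {x} = 0)
    (h : Integrable (normalizedKernel Ω G β x) (weightedMeasure Ω β μ)) : Integrable (G x) μ := by
  rw [weightedMeasure, integrable_withDensity_iff_integrable_smul'
    (measurable_ofReal_bdist_rpow Ω β) (by simp)] at h
  exact h.congr (ae_bdist_rpow_smul_normalizedKernel hN ho hb hμ hx hνx)

end

theorem weightedNorm_eq (μ : SignedRadonMeasure Ω) (β : ℝ) :
    μ.weightedNorm β =
      weightedMeasure Ω β μ.posPart univ + weightedMeasure Ω β μ.negPart univ := by
  rw [weightedMeasure_univ μ.posPart_compl, weightedMeasure_univ μ.negPart_compl,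
    SignedRadonMeasure.weightedNorm, SignedRadonMeasure.variation, Measure.restrict_add,
    lintegral_add_measure]

theorem green_ae_eq (hN : 0 < N) (ho : IsOpen Ω) (hb : Bornology.IsBounded Ω)
    (G : Eu N → Eu N → ℝ) {β : ℝ} (α : ℝ) (μ : SignedRadonMeasure Ω)
    (hμ : μ.weightedNorm β < ⊤) :
    (fun x => μ.green G x) =ᵐ[weightedVolume Ω α] fun x =>
      ∫ y, normalizedKernel Ω G β x y ∂(weightedMeasure Ω β μ.posPart) -
        ∫ y, normalizedKernel Ω G β x y ∂(weightedMeasure Ω β μ.negPart) := by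
  rw [weightedNorm_eq, ENNReal.add_lt_top] at hμ
  have : IsFiniteMeasure (weightedMeasure Ω β μ.posPart) := ⟨hμ.1⟩
  have : IsFiniteMeasure (weightedMeasure Ω β μ.negPart) := ⟨hμ.2⟩
  refine (withDensity_absolutelyContinuous _ _).ae_le (?_ : _ =ᵐ[volume.restrict Ω] _)
  filter_upwards [ae_restrict_mem ho.measurableSet,
    ae_restrict_of_ae (ae_measure_singleton_eq_zero hN (weightedMeasure Ω β μ.posPart)),
    ae_restrict_of_ae (ae_measure_singleton_eq_zero hN (weightedMeasure Ω β μ.negPart))]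
    with x hx h1 h2
  rw [integral_normalizedKernel hN ho hb μ.posPart_compl hx h1,
    integral_normalizedKernel hN ho hb μ.negPart_compl hx h2]
  rfl

/-- Reduces the theorem to a singular bound on G(x,y) δ(y)^(-β) and to its pointwise limits at the
points of `closure Ω`. The Jordan parts are treated separately, each being a finite measure after
weighting by δ^β. -/
theorem isCompactGreenMap_of_tendsto (hN : 0 < N) (hΩ : IsC2BoundedDomain Ω)
    {G : Eu N → Eu N → ℝ} {q α β a b C : ℝ} (hq : 1 ≤ q)
    (ha : 0 ≤ a) (ha1 : a < 1) (hb : 0 ≤ b) (hab : a + b < N) (hC : 0 ≤ C)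
    (hG : Measurable ((offDiagonal Ω).domRestrict (Function.uncurry G)))
    (hbound : ∀ x ∈ Ω, ∀ y ∈ Ω, x ≠ y → |G x y * bdist Ω y ^ (-β)| ^ q * bdist Ω x ^ α ≤
      C * (bdist Ω x ^ (-a) * ‖x - y‖ ^ (-b)))
    (hlim : ∀ z ∈ closure Ω, ∃ κ : Eu N → ℝ, ∀ x ∈ Ω, x ≠ z →
      Tendsto (fun y => G x y * bdist Ω y ^ (-β)) (𝓝[Ω] z) (𝓝 (κ x))) :
    IsCompactGreenMap Ω G β α q := by
  set K := normalizedKernel Ω G β with hKdef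
  have ho := hΩ.isOpen
  have hbd := hΩ.isBounded
  have hK : Measurable (Function.uncurry K) := measurable_normalizedKernel ho hG β
  have hKb : ∀ x ∈ Ω, ∀ y ∈ Ω, x ≠ y →
      |K x y| ^ q * bdist Ω x ^ α ≤ C * (bdist Ω x ^ (-a) * ‖x - y‖ ^ (-b)) := by
    intro x hx y hy hxy
    rw [hKdef, normalizedKernel_of_mem hx hy hxy]
    exact hbound x hx y hy hxy
  have hKlim : ∀ z ∈ closure Ω, ∃ k : Eu N → ℝ, Measurable k ∧
      MemLp k (ENNReal.ofReal q) (weightedVolume Ω α) ∧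
      Tendsto (fun y => eLpNorm (fun x => K x y - k x) (ENNReal.ofReal q) (weightedVolume Ω α))
        (𝓝[Ω] z) (𝓝 0) := by
    intro z hz
    obtain ⟨κ, hκ⟩ := hlim z hz
    refine exists_limit_of_tendsto hN hΩ hq ha ha1 hb hab hC hK hKb hz (κ := κ)
      fun x hx hxz => (hκ x hx hxz).congr' ?_
    filter_upwards [self_mem_nhdsWithin,
      mem_nhdsWithin_of_mem_nhds (isOpen_ne.mem_nhds hxz.symm)] with y hy hyx
    exact (normalizedKernel_of_mem hx hy (Ne.symm hyx)).symm
  obtain ⟨B, hB0, hB⟩ := exists_lintegral_singular_le hN hΩ ha ha1 hb hab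
  have hKB : ∀ y ∈ Ω, eLpNorm (fun x => K x y) (ENNReal.ofReal q) (weightedVolume Ω α) ≤
      ENNReal.ofReal (C * B) ^ (1 / q) := by
    intro y hy
    refine eLpNorm_le_of_singular_bound (by linarith) hC (hB y (subset_closure hy)) ?_
    filter_upwards [ae_restrict_mem ho.measurableSet, ae_restrict_ne hN y] with x hx hxy
      using hKb x hx y hy hxy
  have hBtop : ENNReal.ofReal (C * B) ^ (1 / q) < ⊤ :=
    ENNReal.rpow_lt_top_of_nonneg (by positivity) ENNReal.ofReal_ne_top
  have hp1 : 1 ≤ ENNReal.ofReal q := by simpa using hq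
  have : Fact (1 ≤ ENNReal.ofReal q) := ⟨hp1⟩
  have hp : ENNReal.ofReal q ≠ ⊤ := ENNReal.ofReal_ne_top
  have : SFinite (weightedVolume Ω α) := by unfold weightedVolume; infer_instance
  have hsupp : ∀ {ν : Measure (Eu N)}, ν Ωᶜ = 0 →
      ∀ᵐ y ∂ν, eLpNorm (fun x => K x y) (ENNReal.ofReal q) (weightedVolume Ω α) ≤
        ENNReal.ofReal (C * B) ^ (1 / q) := fun {ν} h => by
    have : ∀ᵐ y ∂ν, y ∈ Ω := by rwa [ae_iff]
    exact this.mono hKB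
  refine ⟨fun μ hμ => ?_, fun μ hμ => ?_, fun μ R hR hμ => ?_⟩
  · rw [weightedNorm_eq, ENNReal.add_lt_top] at hμ
    have : IsFiniteMeasure (weightedMeasure Ω β μ.posPart) := ⟨hμ.1⟩
    have : IsFiniteMeasure (weightedMeasure Ω β μ.negPart) := ⟨hμ.2⟩
    have h1 := ae_integrable_of_eLpNorm_le hp1 hp hK hBtop
      (hsupp (weightedMeasure_compl μ.posPart_compl β))
    have h2 := ae_integrable_of_eLpNorm_le hp1 hp hK hBtop
      (hsupp (weightedMeasure_compl μ.negPart_compl β))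
    rw [weightedVolume, ae_withDensity_iff (measurable_ofReal_bdist_rpow Ω α)] at h1 h2
    filter_upwards [h1, h2, ae_restrict_mem ho.measurableSet,
      ae_restrict_of_ae (ae_measure_singleton_eq_zero hN (weightedMeasure Ω β μ.posPart)),
      ae_restrict_of_ae (ae_measure_singleton_eq_zero hN (weightedMeasure Ω β μ.negPart))]
      with x h1 h2 hx h3 h4
    -- Positivity of the weight δ^α on Ω turns "almost everywhere for δ^α dx" into "almost
    -- everywhere for dx".
    have h0 : ENNReal.ofReal (bdist Ω x ^ α) ≠ 0 := by
      simpa using Real.rpow_pos_of_pos (bdist_pos hN ho hbd hx) α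
    exact (integrable_of_normalizedKernel hN ho hbd μ.posPart_compl hx h3 (h1 h0)).add_measure
      (integrable_of_normalizedKernel hN ho hbd μ.negPart_compl hx h4 (h2 h0))
  · rw [memLp_congr_ae (green_ae_eq hN ho hbd G α μ hμ)]
    rw [weightedNorm_eq, ENNReal.add_lt_top] at hμ
    have : IsFiniteMeasure (weightedMeasure Ω β μ.posPart) := ⟨hμ.1⟩
    have : IsFiniteMeasure (weightedMeasure Ω β μ.negPart) := ⟨hμ.2⟩
    exact (memLp_integral_kernel hp1 hp hK hBtop
      (hsupp (weightedMeasure_compl μ.posPart_compl β))).sub (memLp_integral_kernel hp1 hp hK hBtop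
      (hsupp (weightedMeasure_compl μ.negPart_compl β)))
  · have hS := isCompact_closure_of_bounded hbd
    have hpos : ∀ n, weightedMeasure Ω β (μ n).posPart univ ≤ R := fun n =>
      le_self_add.trans ((weightedNorm_eq (μ n) β).symm.trans_le (hμ n))
    have hneg : ∀ n, weightedMeasure Ω β (μ n).negPart univ ≤ R := fun n =>
      le_add_self.trans ((weightedNorm_eq (μ n) β).symm.trans_le (hμ n))
    obtain ⟨k₁, hk₁, u₁, hu₁, ht₁⟩ := exists_subseq_tendsto_integral_kernel hp hK hBtop hKB hS
      subset_closure hKlim hR (fun n => weightedMeasure Ω β (μ n).posPart)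
      (fun n => weightedMeasure_compl (μ n).posPart_compl β) hpos
    obtain ⟨k₂, hk₂, u₂, hu₂, ht₂⟩ := exists_subseq_tendsto_integral_kernel hp hK hBtop hKB hS
      subset_closure hKlim hR (fun n => weightedMeasure Ω β (μ (k₁ n)).negPart)
      (fun n => weightedMeasure_compl (μ (k₁ n)).negPart_compl β) (fun n => hneg (k₁ n))
    refine ⟨k₁ ∘ k₂, hk₁.comp hk₂, fun x => u₁ x - u₂ x, hu₁.sub hu₂, ?_⟩
    have hsum := (ht₁.comp hk₂.tendsto_atTop).add ht₂
    rw [add_zero] at hsum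
    refine tendsto_of_tendsto_of_tendsto_of_le_of_le tendsto_const_nhds hsum
      (fun _ => zero_le) fun n => ?_
    set j := k₁ (k₂ n) with hj
    have : IsFiniteMeasure (weightedMeasure Ω β (μ j).posPart) := ⟨(hpos j).trans_lt hR⟩
    have : IsFiniteMeasure (weightedMeasure Ω β (μ j).negPart) := ⟨(hneg j).trans_lt hR⟩
    calc eLpNorm (fun x => (μ ((k₁ ∘ k₂) n)).green G x - (u₁ x - u₂ x)) (ENNReal.ofReal q)
          (weightedVolume Ω α)
        = eLpNorm ((fun x => ∫ y, K x y ∂(weightedMeasure Ω β (μ j).posPart) - u₁ x) -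
            fun x => ∫ y, K x y ∂(weightedMeasure Ω β (μ j).negPart) - u₂ x) (ENNReal.ofReal q)
            (weightedVolume Ω α) := by
          apply eLpNorm_congr_ae
          filter_upwards [green_ae_eq hN ho hbd G α (μ j) ((hμ j).trans_lt hR)] with x hx
          simp only [Function.comp, ← hj, hx, Pi.sub_apply, hKdef]
          ring
      _ ≤ _ := eLpNorm_sub_le
          ((aestronglyMeasurable_integral_kernel hK _).sub hu₁.aestronglyMeasurable)
          ((aestronglyMeasurable_integral_kernel hK _).sub hu₂.aestronglyMeasurable) hp1

/-! ### Singular bound and boundary limits of the Green function -/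

section GreenFunction

variable {s γ β : ℝ} {GG : (Eu N → ℝ) → Eu N → ℝ} {G : Eu N → Eu N → ℝ}

theorem IsGreenFunction.abs_mul_le (hG : IsGreenFunction Ω s γ GG G) :
    ∃ C : ℝ, 0 < C ∧ ∀ x ∈ Ω, ∀ y ∈ Ω, x ≠ y → ∀ β : ℝ,
      |G x y * bdist Ω y ^ (-β)| ≤ C * (greenProfile Ω s γ x y * bdist Ω y ^ (-β)) := by
  obtain ⟨c, C, -, hC, h⟩ := hG.estimate
  refine ⟨C, hC, fun x hx y hy hxy β => ?_⟩
  have h0 : 0 ≤ bdist Ω y ^ (-β) := Real.rpow_nonneg Metric.infDist_nonneg _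
  rw [abs_of_nonneg (mul_nonneg (hG.pos x hx y hy hxy).le h0), ← mul_assoc]
  gcongr
  exact (h x hx y hy hxy).2

theorem IsGreenFunction.exists_singular_bound (hN : 2 * s < (N : ℝ)) (hs : 0 < s)
    (hΩ : IsC2BoundedDomain Ω) (hG : IsGreenFunction Ω s γ GG G) {α q : ℝ}
    (hβ : 0 ≤ β) (hβγ : β ≤ γ) (hα : Admissible N s β α) (hq : 1 ≤ q) (hq2 : q < critExp N s β α) :
    ∃ a b C : ℝ, 0 ≤ a ∧ a < 1 ∧ 0 ≤ b ∧ a + b < N ∧ 0 ≤ C ∧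
      ∀ x ∈ Ω, ∀ y ∈ Ω, x ≠ y → |G x y * bdist Ω y ^ (-β)| ^ q * bdist Ω x ^ α ≤
        C * (bdist Ω x ^ (-a) * ‖x - y‖ ^ (-b)) := by
  have hN0 : 0 < N := by
    have : (0 : ℝ) < N := by linarith
    exact_mod_cast this
  obtain ⟨D, hD, hbD, -⟩ := exists_bdist_le hΩ.isBounded
  obtain ⟨a, b, C, ha, ha1, hb, hab, hC, h⟩ := exists_exponents hN hβ hβγ hα hq hq2 hD
  obtain ⟨C', hC', h'⟩ := hG.abs_mul_le
  refine ⟨a, b, C' ^ q * C, ha, ha1, hb, hab, by positivity, fun x hx y hy hxy => ?_⟩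
  have hr : 0 < ‖x - y‖ := norm_pos_iff.mpr (sub_ne_zero.mpr hxy)
  have hdx := bdist_pos hN0 hΩ.isOpen hΩ.isBounded hx
  have hdy := bdist_pos hN0 hΩ.isOpen hΩ.isBounded hy
  have h1 := h ‖x - y‖ _ _ hr hdx hdy (hbD x hx) (bdist_le_add x y)
  have hp : 0 ≤ greenProfile Ω s γ x y * bdist Ω y ^ (-β) := by unfold greenProfile; positivity
  calc _ ≤ (C' * (greenProfile Ω s γ x y * bdist Ω y ^ (-β))) ^ q * bdist Ω x ^ α := by
        gcongr
        exact h' x hx y hy hxy β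
    _ = C' ^ q * ((greenProfile Ω s γ x y * bdist Ω y ^ (-β)) ^ q * bdist Ω x ^ α) := by
        rw [Real.mul_rpow hC'.le hp, mul_assoc]
    _ ≤ C' ^ q * (C * (bdist Ω x ^ (-a) * ‖x - y‖ ^ (-b))) :=
        mul_le_mul_of_nonneg_left h1 (by positivity)
    _ = _ := by ring

theorem tendsto_mul_bdist_of_mem (hN : 0 < N) (ho : IsOpen Ω) (hb : Bornology.IsBounded Ω)
    (hG : ContinuousOn (Function.uncurry G) (offDiagonal Ω)) {x z : Eu N} (hx : x ∈ Ω) (hz : z ∈ Ω)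
    (hxz : x ≠ z) :
    Tendsto (fun y => G x y * bdist Ω y ^ (-β)) (𝓝[Ω] z) (𝓝 (G x z * bdist Ω z ^ (-β))) := by
  have h1 : Tendsto (fun y => (x, y)) (𝓝[Ω] z) (𝓝[offDiagonal Ω] (x, z)) := by
    refine tendsto_nhdsWithin_iff.mpr ⟨?_, ?_⟩
    · exact ((Continuous.prodMk_right x).tendsto z).mono_left nhdsWithin_le_nhds
    · filter_upwards [self_mem_nhdsWithin,
        mem_nhdsWithin_of_mem_nhds (isOpen_ne.mem_nhds hxz.symm)] with y hy hyx
      exact ⟨hx, hy, Ne.symm hyx⟩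
  have h2 : Tendsto (fun y => G x y) (𝓝[Ω] z) (𝓝 (G x z)) :=
    (hG (x, z) ⟨hx, hz, hxz⟩).tendsto.comp h1
  refine h2.mul (Tendsto.rpow_const ?_ (Or.inl (bdist_pos hN ho hb hz).ne'))
  exact ((continuous_bdist Ω).tendsto z).mono_left nhdsWithin_le_nhds

theorem IsGreenFunction.tendsto_mul_bdist_zero (hN : 0 < N)
    (hΩ : IsC2BoundedDomain Ω) (hG : IsGreenFunction Ω s γ GG G) (hβ : 0 ≤ β) (hβγ : β < γ)
    {x z : Eu N} (hx : x ∈ Ω) (hz : z ∉ Ω) :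
    Tendsto (fun y => G x y * bdist Ω y ^ (-β)) (𝓝[Ω] z) (𝓝 0) := by
  obtain ⟨C, hC, h⟩ := hG.abs_mul_le
  have hxz : x ≠ z := fun h => hz (h ▸ hx)
  have hnorm : Tendsto (fun y => ‖x - y‖) (𝓝[Ω] z) (𝓝 ‖x - z‖) :=
    ((continuous_const.sub continuous_id).norm.tendsto z).mono_left nhdsWithin_le_nhds
  have hδ : Tendsto (bdist Ω) (𝓝[Ω] z) (𝓝 0) := by
    have h0 : bdist Ω z = 0 := Metric.infDist_zero_of_mem hz
    rw [← h0]
    exact ((continuous_bdist Ω).tendsto z).mono_left nhdsWithin_le_nhds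
  have hbd : Tendsto (fun y => C * (2 ^ γ * ‖x - y‖ ^ (-((N : ℝ) - 2 * s + γ)) *
      bdist Ω y ^ (γ - β))) (𝓝[Ω] z) (𝓝 0) := by
    have h1 := (((hnorm.rpow_const (p := -((N : ℝ) - 2 * s + γ))
      (Or.inl (norm_ne_zero_iff.mpr (sub_ne_zero.mpr hxz)))).const_mul ((2 : ℝ) ^ γ)).mul
      (hδ.rpow_const (p := γ - β) (Or.inr (by linarith)))).const_mul C
    rwa [Real.zero_rpow (by linarith), mul_zero, mul_zero] at h1
  refine squeeze_zero_norm' ?_ hbd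
  filter_upwards [self_mem_nhdsWithin,
    mem_nhdsWithin_of_mem_nhds (isOpen_ne.mem_nhds hxz.symm)] with y hy hyx
  have hr : 0 < ‖x - y‖ := norm_pos_iff.mpr (sub_ne_zero.mpr (Ne.symm hyx))
  have hdx := bdist_pos hN hΩ.isOpen hΩ.isBounded hx
  have hdy := bdist_pos hN hΩ.isOpen hΩ.isBounded hy
  -- Taken with β = γ and θ = 0, so the profile absorbs the full δ(y)^(-γ). What remains is
  -- δ(y)^(γ-β), which tends to 0 at the boundary.
  have h1 := profile_le (n := (N : ℝ) - 2 * s) (γ := γ) (θ := 0) hr hdx hdy (bdist_le_add x y)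
    (hβ.trans hβγ.le) le_rfl (by linarith) (by linarith)
  rw [neg_zero, Real.rpow_zero, mul_one, sub_zero] at h1
  have h2 : bdist Ω y ^ (-β) = bdist Ω y ^ (-γ) * bdist Ω y ^ (γ - β) := by
    rw [← Real.rpow_add hdy]; ring_nf
  rw [Real.norm_eq_abs]
  calc _ ≤ C * (greenProfile Ω s γ x y * bdist Ω y ^ (-β)) := h x hx y hy (Ne.symm hyx) β
    _ = C * (greenProfile Ω s γ x y * bdist Ω y ^ (-γ) * bdist Ω y ^ (γ - β)) := by
        rw [h2, mul_assoc]
    _ ≤ _ := by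
        refine mul_le_mul_of_nonneg_left (mul_le_mul_of_nonneg_right h1 ?_) hC.le
        positivity

theorem tendsto_mul_bdist_of_martin {M : Eu N → Eu N → ℝ} {x z : Eu N} (hx : x ∈ Ω)
    (hM : Tendsto (fun p : Eu N × Eu N => G p.1 p.2 / bdist Ω p.2 ^ γ)
        (𝓝[Ω ×ˢ Ω] (x, z)) (𝓝 (M x z))) :
    Tendsto (fun y => G x y * bdist Ω y ^ (-γ)) (𝓝[Ω] z) (𝓝 (M x z)) := by
  have h1 : Tendsto (fun y => (x, y)) (𝓝[Ω] z) (𝓝[Ω ×ˢ Ω] (x, z)) := by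
    refine tendsto_nhdsWithin_iff.mpr ⟨?_, ?_⟩
    · exact ((Continuous.prodMk_right x).tendsto z).mono_left nhdsWithin_le_nhds
    · filter_upwards [self_mem_nhdsWithin] with y hy using ⟨hx, hy⟩
  refine (hM.comp h1).congr fun y => ?_
  rw [Function.comp, Real.rpow_neg (show 0 ≤ bdist Ω y from Metric.infDist_nonneg), div_eq_mul_inv]

end GreenFunction

end GreenCompactness

theorem theorem3p1 {N : ℕ} {s γ : ℝ} (hs : 0 < s) (hs1 : s ≤ 1) (hγ : 0 < γ) (hγ1 : γ ≤ 1)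
    (hN : 2 * s < (N : ℝ))
    (Ω : Set (GreenCompactness.Eu N)) (hΩ : GreenCompactness.IsC2BoundedDomain Ω)
    (L : GreenCompactness.L2 Ω →ₗ.[ℝ] GreenCompactness.L2 Ω)
    (GG : (GreenCompactness.Eu N → ℝ) → GreenCompactness.Eu N → ℝ)
    (G : GreenCompactness.Eu N → GreenCompactness.Eu N → ℝ)
    (hG1 : GreenCompactness.IsGreenOperator Ω L GG)
    (hG2 : GreenCompactness.IsGreenFunction Ω s γ GG G)
    (hG3 : ContinuousOn (Function.uncurry G) (GreenCompactness.offDiagonal Ω)) :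
    (∀ γ' : ℝ, 0 ≤ γ' → γ' < γ → ∀ α : ℝ, GreenCompactness.Admissible N s γ' α →
      ∀ q : ℝ, 1 ≤ q → q < GreenCompactness.critExp N s γ' α →
        GreenCompactness.IsCompactGreenMap Ω G γ' α q) ∧
    (GreenCompactness.HasMartinLimit Ω γ G →
      ∀ α : ℝ, GreenCompactness.Admissible N s γ α →
      ∀ q : ℝ, 1 ≤ q → q < GreenCompactness.critExp N s γ α →
        GreenCompactness.IsCompactGreenMap Ω G γ α q) := by
  open GreenCompactness in
  have hN0 : 0 < N := by
    have : (0 : ℝ) < N := by linarith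
    exact_mod_cast this
  refine ⟨fun β hβ hβγ α hα q hq hq2 => ?_, fun ⟨M, hM, _⟩ α hα q hq hq2 => ?_⟩
  · obtain ⟨a, b, C, ha, ha1, hb, hab, hC, h⟩ :=
      hG2.exists_singular_bound hN hs hΩ hβ hβγ.le hα hq hq2
    refine isCompactGreenMap_of_tendsto hN0 hΩ hq ha ha1 hb hab hC hG2.measurable h fun z hz => ?_
    by_cases hzΩ : z ∈ Ω
    · exact ⟨_, fun x hx hxz => tendsto_mul_bdist_of_mem hN0 hΩ.isOpen hΩ.isBounded hG3 hx hzΩ hxz⟩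
    · exact ⟨_, fun x hx _ => hG2.tendsto_mul_bdist_zero hN0 hΩ hβ hβγ hx hzΩ⟩
  · obtain ⟨a, b, C, ha, ha1, hb, hab, hC, h⟩ :=
      hG2.exists_singular_bound hN hs hΩ hγ.le le_rfl hα hq hq2
    refine isCompactGreenMap_of_tendsto hN0 hΩ hq ha ha1 hb hab hC hG2.measurable h fun z hz => ?_
    by_cases hzΩ : z ∈ Ω
    · exact ⟨_, fun x hx hxz => tendsto_mul_bdist_of_mem hN0 hΩ.isOpen hΩ.isBounded hG3 hx hzΩ hxz⟩
    · have hzf : z ∈ frontier Ω := ⟨hz, by rwa [hΩ.isOpen.interior_eq]⟩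
      exact ⟨_, fun x hx _ => tendsto_mul_bdist_of_martin hx (hM x hx z hzf).2⟩
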